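/- **The structure.** Let $F_0=0$, $F_1=F_2=1$, $F_i=F_{i-1}+F_{i-2}$. A *next generation Fibonacci heap* (FH:TNG) stores $n$ distinct elements of a linear order in pairwise disjoint sets $S_3,S_4,\dots$, finitely many of them nonempty. Each nonempty $S_i$ has a pivot $p_i\in[-\infty,\infty)$ with $p_i\le y$ for all $y\in S_i$ and $y<p_i$ for all $y\in S_j$, $j<i$; always $p_3=-\infty$. The invariants are: $F_i\le|S_i|\le F_{i+3}$ for every nonempty $S_i$, except that $S_3$ has no minimum size; at most eight consecutive sets are empty (before the last nonempty set); at most two consecutive sets are nonempty. **Insert.** To insert a new element $x$, a binary search finds the last nonempty $S_i$ with $p_i\le x$ and adds $x$ to it, or adds $x$ to $S_3$ if $x$ is smaller than all pivots. Call the receiving set $S_j$. The search runs over the slots; each round passes over the empty slots after the middle slot and makes one comparison, and its cost is the number of empty slots passed plus the number of rounds. If now $|S_j|\ge F_{j+3}$, a single overflow operation is performed on $S_j$. Then split-ups and merge-downs are performed, in any order, as long as one is applicable. The operations and their nominal costs are: - *overflow-down* on $S_i$ ($|S_i|\ge F_{i+3}$, $S_{i+1}=\emptyset$): move $S_i$ and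 its pivot to slot $i+1$; cost $1$. - *overflow-thru* on $S_i$ ($|S_i|\ge F_{i+3}$, $S_{i+1}\neq\emptyset$, $S_{i+2}=\emptyset$): the $|S_i|$ largest elements of $S_i\cup S_{i+1}$ become $S_{i+2}$, the others become $S_{i+1}$, $S_i$ becomes empty, and the new pivots are the minima of the new sets; cost $F_{i-4}$ (cost $1$ if $i\le 4$). - *split-up* on $S_i\ne\emptyset$, $i\ge 12$ ($S_{i-1},\dots,S_{i-9}$ empty): $S_i$ is split into its smaller elements, which become $S_{i-2}$, and its larger ones, which become $S_{i-1}$, where for some $l$ with $F_{l-1}\le|S_i|\le F_l$ the new sizes satisfy $F_{l-2}\le|S_{i-1}|\le F_{l-1}$ and $F_{l-3}\le|S_{i-2}|\le F_{l-2}$; the new pivots are the minima; cost $F_{i-6}$. - *merge-down* on $S_i$ ($S_{i-2},S_{i-1},S_i$ nonempty, $S_{i+1}=\emptyset$): $S_{i-1}\cup S_i$ becomes $S_{i+1}$ with pivot $p_{i-1}$, and $S_{i-1},S_i$ become empty; cost $1$. The nominal cost of Insert is the cost of the binary search, plus $1$, plus the nominal costs of the operations performed. **The potential.** $\Phi=\sum_i(\phi^{\rm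 up}_i+\phi^{\rm size}_i+\phi^{\rm set}_i)$. All three terms are $0$ if $S_i=\emptyset$. Otherwise $\phi^{\rm set}_i=1$; $\phi^{\rm up}_i=\max\{0,F_{i-3}-\sum_{j<i}|S_j|\}$; and $\phi^{\rm size}_i$ is $F_{i+1}-|S_i|$ if $F_i\le|S_i|<F_{i+1}$, is $|S_i|-F_{i+2}$ if $|S_i|>F_{i+2}$, and is $0$ in all other cases. The amortized cost of an operation is its nominal cost plus the change of $\Phi$. **Lemma.** In an FH:TNG that holds $n$ elements, Insert takes amortized $O(\lg\lg n)$ time. In detail, there is an absolute constant $C$ such that, with $\Lambda=\max\{1,\lg\lg n\}$ (and $\Lambda=1$ for $n\le 1$), the following holds for every heap satisfying the invariants and every element $x$ not in it. 1. The binary search over the pivots costs at most $C\Lambda$. 2. Adding $x$ to $S_j$ does not increase the total up potential and increases the total size potential by at most $1$. It leaves the total nonempty potential unchanged if $S_j$ was nonempty; otherwise $j=3$ and the nonempty potential grows by $1$. 3. The procedure has a completed execution, and the number of operations performed in executions is bounded for the given heap and $x$. Every execution that can no longer be continued ends in a heap that satisfies all invariants and holds exactly the old elements and $x$. 4. In every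 (possibly still incomplete) execution, each overflow, split-up and merge-down has amortized cost at most $0$, with one exception: a merge-down on $S_5$ when $|S_3|=1$ has amortized cost at most $1$ and happens at most once. All these operations together have amortized cost at most $1$, and the whole insertion has amortized cost at most $C\Lambda$. 5. For every $K\in\mathbb N$ there are constants $a>0$ and $C'$ such that $T+a\,\Delta\Phi\le C'\Lambda$ in every (possibly incomplete) execution. Here $\Delta\Phi$ is the total change of $\Phi$, and $T$ is the time when each unit of search cost, the addition of $x$, each overflow-down and each merge-down take $K$ steps, each overflow-thru on $S_i$ takes $K(|S_i|+|S_{i+1}|)$ steps, and each split-up on $S_i$ takes $K|S_i|$ steps. -/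

import Mathlib

universe u

namespace FHTNG

/-- The data of the heap: the set `S_i` kept in slot `i` (absent iff empty) and the pivot `p_i` of
slot `i`, which has a meaning only where `S_i` is present. The pivot `⊥` stands for `-∞`. -/
structure Heap (α : Type u) where
  sets : ℕ → Finset α
  pivot : ℕ → WithBot α

/-- The restructuring operations, labelled by the index of the set on which they are called. -/
inductive Op where
  | overflowDown (i : ℕ)
  | overflowThru (i : ℕ)
  | splitUp (i : ℕ)
  | mergeDown (i : ℕ)

namespace Heap

variable {α : Type u}

/-- The elements stored in the heap. -/
def elems (h : Heap α) : Set α := {y | ∃ i, y ∈ h.sets i}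

/-- The number of stored elements. -/
noncomputable def size (h : Heap α) : ℕ := ∑ᶠ i, (h.sets i).card

/-- The index of the last nonempty set (`0` for the empty heap). -/
noncomputable def top (h : Heap α) : ℕ := sSup {i | (h.sets i).Nonempty}

/-- The number of elements stored above slot `i`, that is, in slots of smaller index. -/
def above (h : Heap α) (i : ℕ) : ℕ := ∑ j ∈ Finset.range i, (h.sets j).card

/-- The nonempty potential of slot `i`. -/
def setPot (h : Heap α) (i : ℕ) : ℕ := if (h.sets i).Nonempty then 1 else 0

/-- The size potential of slot `i`: linear near both ends of the size range, `0` in the middle.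
The only sizes below `Nat.fib i` that occur are those of `S_3`, which has no minimum size. -/
def sizePot (h : Heap α) (i : ℕ) : ℕ :=
  if ¬ (h.sets i).Nonempty then 0
  else if Nat.fib i ≤ (h.sets i).card ∧ (h.sets i).card < Nat.fib (i + 1) then
    Nat.fib (i + 1) - (h.sets i).card
  else if Nat.fib (i + 2) < (h.sets i).card then (h.sets i).card - Nat.fib (i + 2)
  else 0

/-- The up potential of slot `i` (truncated subtraction is the maximum with `0`). -/
def upPot (h : Heap α) (i : ℕ) : ℕ :=
  if i ≤ 2 ∨ ¬ (h.sets i).Nonempty then 0 else Nat.fib (i - 3) - h.above i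

/-- The potential of the heap. -/
noncomputable def potential (h : Heap α) : ℕ :=
  ∑ᶠ i, (h.upPot i + h.sizePot i + h.setPot i)

/-- `lg lg n` for the current number `n` of elements, replaced by `1` where it is smaller. -/
noncomputable def lgLg (h : Heap α) : ℝ := max 1 (Real.logb 2 (Real.logb 2 (h.size : ℝ)))

/-- The number of absent slots among `m, m + 1, …` before the first present one, at most `d`. -/
def scan (h : Heap α) : ℕ → ℕ → ℕ
  | 0, _ => 0
  | d + 1, m => if (h.sets m).Nonempty then 0 else h.scan d (m + 1) + 1

variable [LinearOrder α]

/-- Binary search in the slots `lo, …, hi` for the last present slot whose pivot is at most `x`,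
with `lo` as the default. A round goes from the middle slot on to the next present slot and compares
`x` with its pivot. The second component counts the absent slots passed, plus one
for each round. -/
def searchFrom (h : Heap α) (x : α) (lo hi : ℕ) : ℕ × ℕ :=
  if _hlt : lo < hi then
    let m := (lo + hi + 1) / 2
    let g := h.scan (hi + 1 - m) m
    if m + g ≤ hi ∧ h.pivot (m + g) ≤ (x : WithBot α) then
      let r := h.searchFrom x (m + g) hi
      (r.1, r.2 + g + 1)
    else
      let r := h.searchFrom x lo (m - 1)
      (r.1, r.2 + g + 1)
  else (lo, 0)
termination_by hi - lo
decreasing_by all_goals omega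

/-- The slot that receives `x`: the last present slot whose pivot is at most `x`; slot `3` if `x` is
smaller than all pivots. -/
noncomputable def slot (h : Heap α) (x : α) : ℕ := (h.searchFrom x 3 h.top).1

/-- The cost of the binary search over the pivots. -/
noncomputable def searchCost (h : Heap α) (x : α) : ℕ := (h.searchFrom x 3 h.top).2

/-- The invariants of the data structure. -/
structure Valid (h : Heap α) : Prop where
  finite : ∃ N, ∀ i, N ≤ i → h.sets i = ∅
  first : ∀ i, i < 3 → h.sets i = ∅
  pivot_first : h.pivot 3 = ⊥
  pivot_le : ∀ i, ∀ y ∈ h.sets i, h.pivot i ≤ (y : WithBot α)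
  lt_pivot : ∀ i k, i < k → (h.sets k).Nonempty → ∀ y ∈ h.sets i, (y : WithBot α) < h.pivot k
  min_size : ∀ i, 4 ≤ i → (h.sets i).Nonempty → Nat.fib i ≤ (h.sets i).card
  max_size : ∀ i, 3 ≤ i → (h.sets i).card ≤ Nat.fib (i + 3)
  /-- At most eight empty sets in a row (before the last nonempty set). -/
  consecutive_empty : ∀ i, 3 ≤ i → (∀ d, d < 9 → h.sets (i + d) = ∅) →
    ∀ k, i ≤ k → h.sets k = ∅
  /-- At most two nonempty sets in a row. -/
  consecutive_nonempty : ∀ i, ¬ ((h.sets i).Nonempty ∧ (h.sets (i + 1)).Nonempty ∧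
    (h.sets (i + 2)).Nonempty)

/-- The heap after the plain insertion of `x`, before any restructuring. -/
noncomputable def addTo (h : Heap α) (x : α) : Heap α where
  sets := Function.update h.sets (h.slot x) (insert x (h.sets (h.slot x)))
  pivot := h.pivot

/-- The set that has received `x` is full (or beyond), so that an overflow operation is due. -/
def Full (h : Heap α) (x : α) : Prop :=
  Nat.fib (h.slot x + 3) ≤ ((h.addTo x).sets (h.slot x)).card

end Heap

namespace Op

variable {α : Type u} [LinearOrder α]

/-- `op.Step h h'`: the operation `op` may be called in `h`, and it can lead to `h'`. -/
def Step : Op → Heap α → Heap α → Prop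
  | overflowDown i, h, h' =>
      Nat.fib (i + 3) ≤ (h.sets i).card ∧ h.sets (i + 1) = ∅ ∧
      h' = { sets := Function.update (Function.update h.sets i ∅) (i + 1) (h.sets i)
             pivot := Function.update h.pivot (i + 1) (h.pivot i) }
  | overflowThru i, h, h' =>
      Nat.fib (i + 3) ≤ (h.sets i).card ∧ (h.sets (i + 1)).Nonempty ∧ h.sets (i + 2) = ∅ ∧
      ∃ (A B : Finset α) (a b : α),
        A ∪ B = h.sets i ∪ h.sets (i + 1) ∧ (∀ y ∈ A, ∀ z ∈ B, y < z) ∧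
        B.card = (h.sets i).card ∧ IsLeast (A : Set α) a ∧ IsLeast (B : Set α) b ∧
        h' = { sets := Function.update (Function.update
                 (Function.update h.sets i ∅) (i + 1) A) (i + 2) B
               pivot := Function.update (Function.update h.pivot (i + 1) a) (i + 2) b }
  | splitUp i, h, h' =>
      12 ≤ i ∧ (h.sets i).Nonempty ∧ (∀ k, i - 9 ≤ k → k < i → h.sets k = ∅) ∧
      ∃ (A B : Finset α) (a b : α) (l : ℕ),
        A ∪ B = h.sets i ∧ (∀ y ∈ A, ∀ z ∈ B, y < z) ∧
        (Nat.fib (l + 2) ≤ (h.sets i).card ∧ (h.sets i).card ≤ Nat.fib (l + 3)) ∧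
        (Nat.fib (l + 1) ≤ B.card ∧ B.card ≤ Nat.fib (l + 2)) ∧
        (Nat.fib l ≤ A.card ∧ A.card ≤ Nat.fib (l + 1)) ∧
        IsLeast (A : Set α) a ∧ IsLeast (B : Set α) b ∧
        h' = { sets := Function.update (Function.update
                 (Function.update h.sets i ∅) (i - 1) B) (i - 2) A
               pivot := Function.update (Function.update h.pivot (i - 1) b) (i - 2) a }
  | mergeDown i, h, h' =>
      2 ≤ i ∧ (h.sets (i - 2)).Nonempty ∧ (h.sets (i - 1)).Nonempty ∧ (h.sets i).Nonempty ∧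
      h.sets (i + 1) = ∅ ∧
      h' = { sets := Function.update (Function.update
               (Function.update h.sets (i - 1) ∅) i ∅) (i + 1) (h.sets (i - 1) ∪ h.sets i)
             pivot := Function.update h.pivot (i + 1) (h.pivot (i - 1)) }

/-- The nominal cost of an operation. -/
def nominalCost : Op → ℕ
  | overflowDown _ => 1
  | overflowThru i => max 1 (Nat.fib (i - 4))
  | splitUp i => Nat.fib (i - 6)
  | mergeDown _ => 1

/-- The time of an operation called in `h`: `K` for concatenating or moving linked lists, and `K`
per element of the sets involved for selecting, partitioning and finding the new pivots. -/
def time (K : ℕ) : Op → Heap α → ℕ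
  | overflowDown _, _ => K
  | overflowThru i, h => K * ((h.sets i).card + (h.sets (i + 1)).card)
  | splitUp i, h => K * (h.sets i).card
  | mergeDown _, _ => K

end Op

/-- One executed operation with the heaps before and after it. -/
structure Exec (α : Type u) where
  op : Op
  before : Heap α
  after : Heap α

/-- The merge-down of `S_4` and `S_5` into `S_6` below a set `S_3` with a single element. -/
def Exec.Exceptional {α : Type u} (e : Exec α) : Prop :=
  e.op = Op.mergeDown 5 ∧ (e.before.sets 3).card = 1

/-- `InsertRun h x es h'`: a partial execution of the insertion of `x` into `h` that has performed
the restructuring operations `es` so far and has reached `h'`. After the plain insertion there is a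
single overflow operation if the receiving set is full, and then split-ups and merge-downs follow in
any order. -/
inductive InsertRun {α : Type u} [LinearOrder α] (h : Heap α) (x : α) :
    List (Exec α) → Heap α → Prop
  | start : InsertRun h x [] (h.addTo x)
  | overflow (op : Op) (h' : Heap α) (hfull : h.Full x)
      (hop : op = Op.overflowDown (h.slot x) ∨ op = Op.overflowThru (h.slot x))
      (hstep : op.Step (h.addTo x) h') :
      InsertRun h x [⟨op, h.addTo x, h'⟩] h'
  | restore (es : List (Exec α)) (h₁ : Heap α) (op : Op) (h₂ : Heap α)
      (hrun : InsertRun h x es h₁) (hdue : es = [] → ¬ h.Full x)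
      (hop : ∃ i, op = Op.splitUp i ∨ op = Op.mergeDown i) (hstep : op.Step h₁ h₂) :
      InsertRun h x (es ++ [⟨op, h₁, h₂⟩]) h₂

/-- A complete execution: no further operation is due. -/
def CompleteRun {α : Type u} [LinearOrder α] (h : Heap α) (x : α)
    (es : List (Exec α)) (h' : Heap α) : Prop :=
  InsertRun h x es h' ∧ ∀ (e : Exec α) (h'' : Heap α), ¬ InsertRun h x (es ++ [e]) h''

/-- The nominal cost of an execution: the search, the linking of the new node, the operations. -/
noncomputable def insertCost {α : Type u} [LinearOrder α] (h : Heap α) (x : α)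
    (es : List (Exec α)) : ℕ :=
  h.searchCost x + 1 + (es.map fun e => e.op.nominalCost).sum

/-- The time of an execution, at `K` for each elementary step. -/
noncomputable def insertTime {α : Type u} [LinearOrder α] (K : ℕ) (h : Heap α) (x : α)
    (es : List (Exec α)) : ℕ :=
  K * (h.searchCost x + 1) + (es.map fun e => e.op.time K e.before).sum

end FHTNG

/-! Each operation rearranges at most three consecutive slots and keeps their joint number of
elements. The number of elements above any other slot, and hence its potential, does not change
(`Window.potential_le`). Amortized costs therefore reduce to inequalities between Fibonacci numbers,
the `slotPot_*` lemmas.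

An overflow on S_i releases at least F_{i+1} of size potential, which covers its cost and the growth
of the up potential. A split-up lives on up potential: with nine empty slots before S_i, at most
F_{i-5} elements are stored above, so replacing the target F_{i-3} by F_{i-5} releases F_{i-4}. That
pays the cost F_{i-6} and the additional set, while the size potential does not grow. A merge-down
is paid by the set that disappears. The new set has no up potential, because S_{i-2} alone reaches
the target F_{i-2}, unless S_{i-2} is S_3 with one element instead of two. The resulting debt of 1
arises only once: that merge-down empties S_4, and neither restoring operation refills it
(`restore_sound`).

Since every operation costs at least 1, the potential bounds the length of an execution, and a heap
in which nothing is applicable satisfies the invariants (`CompleteRun.valid`). The search takes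
logarithmically many rounds in the number of slots, each of bounded cost, and Fibonacci minimum
sizes make the number of slots logarithmic in n (`searchCost_le`). Real time is at most 100 K times
nominal cost, so a scaled potential pays for it. -/

namespace FHTNG

/-! ### Fibonacci inequalities for the potential of single slots. -/

/-- The size potential of slot `i` when it stores `c` elements. -/
def slotSizePot (i c : ℕ) : ℕ :=
  if c = 0 then 0
  else if Nat.fib i ≤ c ∧ c < Nat.fib (i + 1) then Nat.fib (i + 1) - c
  else if Nat.fib (i + 2) < c then c - Nat.fib (i + 2)
  else 0

/-- The up potential of slot `i` when it stores `c` elements and `A` elements are stored above. -/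
def slotUpPot (i A c : ℕ) : ℕ := if i ≤ 2 ∨ c = 0 then 0 else Nat.fib (i - 3) - A

/-- The potential of slot `i` when it stores `c` elements and `A` elements are stored above. -/
def slotPot (i A c : ℕ) : ℕ :=
  slotUpPot i A c + slotSizePot i c + if c = 0 then 0 else 1

@[simp] theorem slotPot_zero (i A : ℕ) : slotPot i A 0 = 0 := by
  simp [slotPot, slotUpPot, slotSizePot]

/-- The size potential drops by exactly F_{i+1}, since the upper threshold moves from F_{i+2} to
F_{i+3}; this pays the cost and the larger up target. Slot `i + 2` does not change and is included
only to fit the window of three slots. The bound F_{i+3} + 1 allows for the newly added element. -/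
theorem slotPot_overflowDown {i A s c : ℕ} (hi : 3 ≤ i) (hs : Nat.fib (i + 3) ≤ s)
    (hs' : s ≤ Nat.fib (i + 3) + 1) :
    1 + (slotPot i A 0 + slotPot (i + 1) (A + 0) s + slotPot (i + 2) (A + 0 + s) c) ≤
      slotPot i A s + slotPot (i + 1) (A + s) 0 + slotPot (i + 2) (A + s + 0) c := by
  simp only [slotPot_zero, add_zero, zero_add]
  suffices 1 + slotPot (i + 1) A s ≤ slotPot i A s by omega
  obtain rfl | ⟨k, rfl⟩ : i = 3 ∨ ∃ k, i = k + 4 := by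
    rcases Nat.lt_or_ge i 4 with h | h
    · left; omega
    · exact Or.inr ⟨i - 4, by omega⟩
  · norm_num [Nat.fib] at hs hs'
    simp only [slotPot, slotUpPot, slotSizePot]
    norm_num [Nat.fib]
    split_ifs <;> omega
  · have h1 : 0 < Nat.fib (k + 1) := Nat.fib_pos.2 (by omega)
    have e2 := @Nat.fib_add_two k
    have e3 := @Nat.fib_add_two (k + 1)
    have e4 := @Nat.fib_add_two (k + 2)
    have e5 := @Nat.fib_add_two (k + 3)
    have e6 := @Nat.fib_add_two (k + 4)
    have e7 := @Nat.fib_add_two (k + 5)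
    have d1 : k + 4 - 3 = k + 1 := by omega
    have d2 : k + 5 - 3 = k + 2 := by omega
    simp only [slotPot, slotUpPot, slotSizePot, add_assoc, Nat.reduceAdd, d1, d2] at *
    split_ifs <;> omega

/-- The size `s` is in the free middle range of slot `i + 2`, so at least F_{i+1} of size potential
vanishes, while slot `i + 1` keeps its cardinality. Slot `i + 2` has no up potential because `t`
already exceeds its target. Only the up potential of slot `i + 1` can be new. -/
theorem slotPot_overflowThru {i A s t : ℕ} (hi : 3 ≤ i) (hs : Nat.fib (i + 3) ≤ s)
    (hs' : s ≤ Nat.fib (i + 3) + 1) (ht : Nat.fib (i + 1) ≤ t) :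
    max 1 (Nat.fib (i - 4)) +
        (slotPot i A 0 + slotPot (i + 1) (A + 0) t + slotPot (i + 2) (A + 0 + t) s) ≤
      slotPot i A s + slotPot (i + 1) (A + s) t + slotPot (i + 2) (A + s + t) 0 := by
  simp only [slotPot_zero, add_zero, zero_add]
  obtain rfl | ⟨k, rfl⟩ : i = 3 ∨ ∃ k, i = k + 4 := by
    rcases Nat.lt_or_ge i 4 with h | h
    · left; omega
    · exact Or.inr ⟨i - 4, by omega⟩
  · norm_num [Nat.fib] at hs hs' ht
    simp only [slotPot, slotUpPot, slotSizePot]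
    norm_num [Nat.fib]
    split_ifs <;> omega
  · have h1 : 0 < Nat.fib (k + 1) := Nat.fib_pos.2 (by omega)
    have e2 := @Nat.fib_add_two k
    have e3 := @Nat.fib_add_two (k + 1)
    have e4 := @Nat.fib_add_two (k + 2)
    have e5 := @Nat.fib_add_two (k + 3)
    have e6 := @Nat.fib_add_two (k + 4)
    have e7 := @Nat.fib_add_two (k + 5)
    have e8 := @Nat.fib_add_two (k + 6)
    have d1 : k + 4 - 3 = k + 1 := by omega
    have d2 : k + 5 - 3 = k + 2 := by omega
    have d3 : k + 6 - 3 = k + 3 := by omega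
    have d4 : k + 4 - 4 = k := by omega
    simp only [slotPot, slotUpPot, slotSizePot, add_assoc, Nat.reduceAdd, d1, d2, d3, d4] at *
    -- Two linear bounds replace the maximum; it differs from `Nat.fib k` only for `k = 0`.
    have hm : max 1 (Nat.fib k) ≤ Nat.fib k + 1 := by omega
    have hm' : max 1 (Nat.fib k) ≤ Nat.fib (k + 2) := by omega
    generalize max 1 (Nat.fib k) = M at *
    have hsz : ∀ v, (if s = 0 then 0
      else if Nat.fib (k + 6) ≤ s ∧ s < Nat.fib (k + 7) then Nat.fib (k + 7) - s
      else if Nat.fib (k + 8) < s then s - Nat.fib (k + 8) else 0) + v = v := by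
      intro v; split_ifs <;> omega
    simp only [hsz]
    generalize (if t = 0 then 0
      else if Nat.fib (k + 5) ≤ t ∧ t < Nat.fib (k + 6) then Nat.fib (k + 6) - t
      else if Nat.fib (k + 7) < t then t - Nat.fib (k + 7) else 0) = T
    split_ifs <;> omega

/-- The possible sizes of the two halves of a set in slot `i` that is split up. -/
theorem split_sizes {i l s a b : ℕ} (hi : 5 ≤ i) (hs : Nat.fib i ≤ s) (hs' : s ≤ Nat.fib (i + 3))
    (hab : a + b = s) (h1 : Nat.fib (l + 2) ≤ s) (h2 : s ≤ Nat.fib (l + 3))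
    (hb : Nat.fib (l + 1) ≤ b) (hb' : b ≤ Nat.fib (l + 2))
    (ha : Nat.fib l ≤ a) (ha' : a ≤ Nat.fib (l + 1)) :
    ∃ d ≤ 2, Nat.fib (i + d) ≤ s ∧ s ≤ Nat.fib (i + d + 1) ∧
      Nat.fib (i + d - 1) ≤ b ∧ b ≤ Nat.fib (i + d) ∧
      Nat.fib (i + d - 2) ≤ a ∧ a ≤ Nat.fib (i + d - 1) := by
  have e2 := @Nat.fib_add_two l
  have e3 := @Nat.fib_add_two (l + 1)
  rcases lt_trichotomy (l + 3) i with h | h | h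
  · have := (Nat.fib_lt_fib (m := l + 3) (n := i) (by omega)).2 h
    omega
  -- Here the size is exactly F_i, which forces both halves to be Fibonacci numbers, and they also
  -- fit `d = 0`.
  · subst h
    refine ⟨0, by omega, ?_⟩
    have e4 := @Nat.fib_add_two (l + 2)
    simp only [add_zero, show l + 3 - 1 = l + 2 by omega, show l + 3 - 2 = l + 1 by omega]
    simp only [add_assoc, Nat.reduceAdd] at *
    omega
  · rcases lt_trichotomy (l + 2) (i + 3) with h' | h' | h'
    · refine ⟨l + 2 - i, by omega, ?_⟩
      have : i + (l + 2 - i) = l + 2 := by omega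
      rw [this]
      exact ⟨h1, h2, hb, hb', ha, ha'⟩
    -- Likewise the size is exactly F_{i+3}, and the forced halves fit `d = 2`.
    · refine ⟨2, le_rfl, ?_⟩
      obtain rfl : l = i + 1 := by omega
      have e4 := @Nat.fib_add_two i
      have := @Nat.fib_le_fib_succ i
      simp only [show i + 2 - 1 = i + 1 by omega, show i + 2 - 2 = i by omega] at *
      simp only [add_assoc, Nat.reduceAdd] at *
      omega
    · have := (Nat.fib_lt_fib (m := i + 3) (n := l + 2) (by omega)).2 h'
      omega

theorem slotSizePot_low {i c : ℕ} (hi : 1 ≤ i) (h1 : Nat.fib i ≤ c) (h2 : c ≤ Nat.fib (i + 1)) :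
    slotSizePot i c = Nat.fib (i + 1) - c := by
  have := Nat.fib_pos.2 hi
  have := @Nat.fib_add_two i
  unfold slotSizePot
  split_ifs <;> omega

theorem slotSizePot_mid {i c : ℕ} (h1 : Nat.fib (i + 1) ≤ c) (h2 : c ≤ Nat.fib (i + 2)) :
    slotSizePot i c = 0 := by
  unfold slotSizePot
  split_ifs <;> omega

theorem slotSizePot_high {i c : ℕ} (h1 : Nat.fib (i + 2) ≤ c) :
    slotSizePot i c = c - Nat.fib (i + 2) := by
  have := @Nat.fib_add_two i
  unfold slotSizePot
  split_ifs <;> omega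

/-- The set and its two halves lie in the same regime of the size potential: low, middle or high for
`d = 0, 1, 2`. Within a regime the potential is linear, and its thresholds satisfy the Fibonacci
recursion, so the potentials of the halves add up to the old one. -/
theorem slotSizePot_splitUp {j d s a b : ℕ} (hj : 1 ≤ j)
    (hab : a + b = s) (hd : d ≤ 2) (h1 : Nat.fib (j + 2 + d) ≤ s) (h2 : s ≤ Nat.fib (j + 2 + d + 1))
    (hb : Nat.fib (j + 2 + d - 1) ≤ b) (hb' : b ≤ Nat.fib (j + 2 + d))
    (ha : Nat.fib (j + 2 + d - 2) ≤ a) (ha' : a ≤ Nat.fib (j + 2 + d - 1)) :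
    slotSizePot j a + slotSizePot (j + 1) b ≤ slotSizePot (j + 2) s := by
  rw [show j + 2 + d - 2 = j + d by omega] at ha
  rw [show j + 2 + d - 1 = j + d + 1 by omega] at ha' hb
  rw [show j + 2 + d = j + d + 2 by omega] at h1 h2 hb'
  obtain rfl | rfl | rfl : d = 0 ∨ d = 1 ∨ d = 2 := by omega
  · rw [slotSizePot_low hj ha ha', slotSizePot_low (by omega) hb hb',
      slotSizePot_low (by omega) h1 h2]
    have e := @Nat.fib_add_two (j + 1)
    simp only [add_assoc, Nat.reduceAdd, add_zero] at *
    omega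
  · rw [slotSizePot_mid ha ha', slotSizePot_mid (i := j + 1) hb hb']
    omega
  · rw [slotSizePot_high ha, slotSizePot_high (i := j + 1) hb, slotSizePot_high (i := j + 2) h1]
    have e := @Nat.fib_add_two (j + 2)
    simp only [add_assoc, Nat.reduceAdd] at *
    omega

/-- Up potential falls from F_{j-1} - A to F_{j-3} - A, since the lower half by itself reaches the
target of slot `j + 1`. As A ≤ F_{j-3}, no truncation occurs and F_{j-2} is released, enough for
F_{j-4} and one more set. -/
theorem slotPot_splitUp {j d A s a b : ℕ} (hj : 10 ≤ j) (hA : A ≤ Nat.fib (j - 3))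
    (hab : a + b = s) (hd : d ≤ 2) (h1 : Nat.fib (j + 2 + d) ≤ s) (h2 : s ≤ Nat.fib (j + 2 + d + 1))
    (hb : Nat.fib (j + 2 + d - 1) ≤ b) (hb' : b ≤ Nat.fib (j + 2 + d))
    (ha : Nat.fib (j + 2 + d - 2) ≤ a) (ha' : a ≤ Nat.fib (j + 2 + d - 1)) :
    Nat.fib (j + 2 - 6) +
        (slotPot j A a + slotPot (j + 1) (A + a) b + slotPot (j + 2) (A + a + b) 0) ≤
      slotPot j A 0 + slotPot (j + 1) (A + 0) 0 + slotPot (j + 2) (A + 0 + 0) s := by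
  simp only [slotPot_zero, add_zero, zero_add]
  have hsum := slotSizePot_splitUp (by omega) hab hd h1 h2 hb hb' ha ha'
  have hage : Nat.fib j ≤ a := (Nat.fib_mono (by omega)).trans ha
  have hsge : Nat.fib j ≤ s := by omega
  clear h1 h2 hb hb' ha ha'
  obtain ⟨k, rfl⟩ : ∃ k, j = k + 4 := ⟨j - 4, by omega⟩
  have h0 : 0 < Nat.fib k := Nat.fib_pos.2 (by omega)
  have h1 : 0 < Nat.fib (k + 1) := Nat.fib_pos.2 (by omega)
  have h4 : 0 < Nat.fib (k + 4) := Nat.fib_pos.2 (by omega)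
  have e2 := @Nat.fib_add_two k
  have e3 := @Nat.fib_add_two (k + 1)
  have u1 : slotUpPot (k + 4) A a ≤ Nat.fib (k + 1) - A := by
    unfold slotUpPot; split_ifs
    · omega
    · rw [show k + 4 - 3 = k + 1 by omega]
  have u2 : slotUpPot (k + 4 + 1) (A + a) b = 0 := by
    unfold slotUpPot; split_ifs
    · rfl
    · rw [show k + 4 + 1 - 3 = k + 2 by omega]
      have : Nat.fib (k + 2) ≤ Nat.fib (k + 4) := Nat.fib_mono (by omega)
      omega
  have u3 : slotUpPot (k + 4 + 2) A s = Nat.fib (k + 3) - A := by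
    unfold slotUpPot; rw [if_neg (by omega), show k + 4 + 2 - 3 = k + 3 by omega]
  rw [show k + 4 - 3 = k + 1 by omega] at hA
  rw [show k + 4 + 2 - 6 = k by omega]
  simp only [slotPot, u2, u3]
  simp only [add_assoc, Nat.reduceAdd] at *
  split_ifs <;> omega

/-- One set fewer pays the cost 1, and the size potential does not grow. The number `e` bounds how
far the elements above fall short of the up target F_{j-1} of the merged set. -/
theorem slotPot_mergeDown {j A a b e : ℕ} (hj : 4 ≤ j) (ha : Nat.fib j ≤ a)
    (hb : Nat.fib (j + 1) ≤ b) (he : e ≤ 1) (hA : Nat.fib (j - 1) ≤ A + e) :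
    1 + (slotPot j A 0 + slotPot (j + 1) (A + 0) 0 + slotPot (j + 2) (A + 0 + 0) (a + b)) ≤
      slotPot j A a + slotPot (j + 1) (A + a) b + slotPot (j + 2) (A + a + b) 0 + e := by
  simp only [slotPot_zero, add_zero, zero_add]
  have h1 : 0 < Nat.fib j := Nat.fib_pos.2 (by omega)
  have h2 : 0 < Nat.fib (j + 1) := Nat.fib_pos.2 (by omega)
  have e2 := @Nat.fib_add_two j
  have e3 := @Nat.fib_add_two (j + 1)
  have e4 := @Nat.fib_add_two (j + 2)
  have hsum : slotSizePot (j + 2) (a + b) ≤ slotSizePot j a + slotSizePot (j + 1) b := by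
    unfold slotSizePot
    simp only [add_assoc, Nat.reduceAdd] at *
    split_ifs <;> omega
  have u1 : slotUpPot (j + 2) A (a + b) ≤ e := by
    unfold slotUpPot
    split_ifs
    · omega
    · rw [show j + 2 - 3 = j - 1 by omega]; omega
  have : a ≠ 0 := by omega
  have : b ≠ 0 := by omega
  simp only [slotPot]
  split_ifs <;> omega

/-- Compares the largest possible sets with nominal costs: F_{i+3} with F_{i-6} for a split-up,
F_{i+5} with F_{i-4} for an overflow-thru. -/
theorem fib_add_nine_le (n : ℕ) (hn : 1 ≤ n) : Nat.fib (n + 9) ≤ 89 * Nat.fib n := by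
  obtain ⟨k, rfl⟩ : ∃ k, n = k + 1 := ⟨n - 1, by omega⟩
  have e2 := @Nat.fib_add_two k
  have hm : Nat.fib k ≤ Nat.fib (k + 1) := Nat.fib_le_fib_succ
  have h := Nat.fib_add (k + 1) 8
  rw [show Nat.fib 8 = 21 from rfl, show Nat.fib (8 + 1) = 34 from rfl] at h
  simp only [add_assoc, Nat.reduceAdd] at *
  omega

/-! ### Changes confined to three slots, and the invariants that survive them. -/

namespace Heap

variable {α : Type u}

theorem upPot_eq (h : Heap α) (i : ℕ) :
    h.upPot i = slotUpPot i (h.above i) (h.sets i).card := by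
  
  rcases (h.sets i).eq_empty_or_nonempty with he | he
  · simp [upPot, slotUpPot, he]
  · simp [upPot, slotUpPot, he, he.card_pos.ne']

theorem sizePot_eq (h : Heap α) (i : ℕ) : h.sizePot i = slotSizePot i (h.sets i).card := by
  
  rcases (h.sets i).eq_empty_or_nonempty with he | he
  · simp [sizePot, slotSizePot, he]
  · simp [sizePot, slotSizePot, he, he.card_pos.ne']

theorem setPot_eq (h : Heap α) (i : ℕ) :
    h.setPot i = if (h.sets i).card = 0 then 0 else 1 := by
  rcases (h.sets i).eq_empty_or_nonempty with he | he
  · simp [setPot, he]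
  · simp [setPot, he, he.card_pos.ne']

theorem pot_eq (h : Heap α) (i : ℕ) :
    h.upPot i + h.sizePot i + h.setPot i = slotPot i (h.above i) (h.sets i).card := by
  rw [upPot_eq, sizePot_eq, setPot_eq, slotPot]

theorem finsum_eq_sum_range {f : ℕ → ℕ} {N : ℕ} (hf : ∀ i, N ≤ i → f i = 0) :
    ∑ᶠ i, f i = ∑ i ∈ Finset.range N, f i := by
  refine finsum_eq_sum_of_support_subset _ fun i hi => ?_
  by_contra hc
  exact hi (hf i (by simpa using hc))

theorem potential_eq {h : Heap α} {N : ℕ} (hN : ∀ i, N ≤ i → h.sets i = ∅) :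
    h.potential = ∑ i ∈ Finset.range N, slotPot i (h.above i) (h.sets i).card := by
  simp only [potential, pot_eq]
  exact finsum_eq_sum_range fun i hi => by simp [hN i hi]

theorem sum_range_window (f : ℕ → ℕ) (a N : ℕ) :
    ∑ i ∈ Finset.range (a + 3 + N), f i =
      ∑ i ∈ Finset.range a, f i + (f a + f (a + 1) + f (a + 2)) +
        ∑ i ∈ Finset.range N, f (a + 3 + i) := by
  rw [Finset.sum_range_add, Finset.sum_range_succ, Finset.sum_range_succ, Finset.sum_range_succ]
  ring

theorem above_succ (h : Heap α) (i : ℕ) : h.above (i + 1) = h.above i + (h.sets i).card :=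
  Finset.sum_range_succ _ _

/-- The heaps `h` and `h'` differ only in the slots `a`, `a + 1`, `a + 2`, and these hold the same
elements altogether. -/
structure Window (h h' : Heap α) (a : ℕ) : Prop where
  sets_eq : ∀ i, i ≠ a → i ≠ a + 1 → i ≠ a + 2 → h'.sets i = h.sets i
  pivot_eq : ∀ i, i ≠ a → i ≠ a + 1 → i ≠ a + 2 → h'.pivot i = h.pivot i
  union : ∀ y, (y ∈ h'.sets a ∨ y ∈ h'.sets (a + 1) ∨ y ∈ h'.sets (a + 2)) ↔
    (y ∈ h.sets a ∨ y ∈ h.sets (a + 1) ∨ y ∈ h.sets (a + 2))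
  card : (h'.sets a).card + (h'.sets (a + 1)).card + (h'.sets (a + 2)).card =
    (h.sets a).card + (h.sets (a + 1)).card + (h.sets (a + 2)).card

namespace Window

variable {h h' : Heap α} {a : ℕ}

theorem above_base (w : Window h h' a) {i : ℕ} (hi : i ≤ a) : h'.above i = h.above i := by
  refine Finset.sum_congr rfl fun j hj => ?_
  have := Finset.mem_range.1 hj
  rw [w.sets_eq j (by omega) (by omega) (by omega)]

theorem above_eq (w : Window h h' a) {i : ℕ} (hi : a + 3 ≤ i) : h'.above i = h.above i := by
  induction i, hi using Nat.le_induction with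
  | base =>
    have := w.card
    have := w.above_base le_rfl
    have e1 : ∀ g : Heap α, g.above (a + 3) =
        g.above a + (g.sets a).card + (g.sets (a + 1)).card + (g.sets (a + 2)).card :=
      fun g => by
        rw [show a + 3 = a + 1 + 1 + 1 from rfl, above_succ, above_succ, above_succ]
    rw [e1, e1]
    omega
  | succ n hn ih =>
    rw [above_succ, above_succ, ih, w.sets_eq n (by omega) (by omega) (by omega)]

theorem elems_eq (w : Window h h' a) : h'.elems = h.elems := by
  have key : ∀ {g g' : Heap α}, (∀ i, i ≠ a → i ≠ a + 1 → i ≠ a + 2 → g'.sets i = g.sets i) →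
      (∀ y, (y ∈ g.sets a ∨ y ∈ g.sets (a + 1) ∨ y ∈ g.sets (a + 2)) →
        (y ∈ g'.sets a ∨ y ∈ g'.sets (a + 1) ∨ y ∈ g'.sets (a + 2))) → g.elems ⊆ g'.elems := by
    rintro g g' hs hu y ⟨i, hi⟩
    by_cases hc : i = a ∨ i = a + 1 ∨ i = a + 2
    · have : y ∈ g.sets a ∨ y ∈ g.sets (a + 1) ∨ y ∈ g.sets (a + 2) := by
        rcases hc with rfl | rfl | rfl <;> simp [hi]
      rcases hu y this with h | h | h <;> exact ⟨_, h⟩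
    · refine ⟨i, ?_⟩
      rwa [hs i (by tauto) (by tauto) (by tauto)]
  exact Set.Subset.antisymm
    (key (fun i h0 h1 h2 => (w.sets_eq i h0 h1 h2).symm) fun y => (w.union y).1)
    (key w.sets_eq fun y => (w.union y).2)

/-- Outside the window both the sets and the counts above them agree, so a comparison of three slots
decides. The slack `e` is there for the exceptional merge-down. -/
theorem potential_le (w : Window h h' a) (hfin : ∃ N, ∀ i, N ≤ i → h.sets i = ∅) {c e : ℕ}
    (hpot : c + (slotPot a (h.above a) (h'.sets a).card +
        slotPot (a + 1) (h.above a + (h'.sets a).card) (h'.sets (a + 1)).card +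
        slotPot (a + 2) (h.above a + (h'.sets a).card + (h'.sets (a + 1)).card)
          (h'.sets (a + 2)).card) ≤
      slotPot a (h.above a) (h.sets a).card +
        slotPot (a + 1) (h.above a + (h.sets a).card) (h.sets (a + 1)).card +
        slotPot (a + 2) (h.above a + (h.sets a).card + (h.sets (a + 1)).card)
          (h.sets (a + 2)).card + e) :
    c + h'.potential ≤ h.potential + e := by
  obtain ⟨N, hN⟩ := hfin
  have hN1 : ∀ i, a + 3 + N ≤ i → h.sets i = ∅ := fun i hi => hN i (by omega)
  have hN2 : ∀ i, a + 3 + N ≤ i → h'.sets i = ∅ := fun i hi => by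
    rw [w.sets_eq i (by omega) (by omega) (by omega)]; exact hN i (by omega)
  rw [potential_eq hN1, potential_eq hN2, sum_range_window, sum_range_window]
  have h1 : ∑ x ∈ Finset.range N, slotPot (a + 3 + x) (h'.above (a + 3 + x))
        (h'.sets (a + 3 + x)).card =
      ∑ x ∈ Finset.range N, slotPot (a + 3 + x) (h.above (a + 3 + x))
        (h.sets (a + 3 + x)).card :=
    Finset.sum_congr rfl fun x _ => by
      rw [w.above_eq (by omega), w.sets_eq _ (by omega) (by omega) (by omega)]
  have h2 : ∑ x ∈ Finset.range a, slotPot x (h'.above x) (h'.sets x).card =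
      ∑ x ∈ Finset.range a, slotPot x (h.above x) (h.sets x).card :=
    Finset.sum_congr rfl fun x hx => by
      have := Finset.mem_range.1 hx
      rw [w.above_base (by omega), w.sets_eq _ (by omega) (by omega) (by omega)]
  have e1 : ∀ g : Heap α, g.above (a + 2) = g.above a + (g.sets a).card + (g.sets (a + 1)).card :=
    fun g => by rw [show a + 2 = a + 1 + 1 from rfl, above_succ, above_succ]
  rw [h1, h2, e1, e1, above_succ, above_succ, w.above_base le_rfl]
  omega

end Window

/-- The invariants that concern the order of the elements and the pivots. -/
structure Ordered [LinearOrder α] (h : Heap α) : Prop where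
  finite : ∃ N, ∀ i, N ≤ i → h.sets i = ∅
  first : ∀ i, i < 3 → h.sets i = ∅
  pivot_first : h.pivot 3 = ⊥
  pivot_le : ∀ i, ∀ y ∈ h.sets i, h.pivot i ≤ (y : WithBot α)
  lt_pivot : ∀ i k, i < k → (h.sets k).Nonempty → ∀ y ∈ h.sets i, (y : WithBot α) < h.pivot k

/-- The invariants that concern the sizes of the sets. -/
structure Sized (h : Heap α) : Prop where
  min_size : ∀ i, 4 ≤ i → (h.sets i).Nonempty → Nat.fib i ≤ (h.sets i).card
  max_size : ∀ i, 3 ≤ i → (h.sets i).card ≤ Nat.fib (i + 3)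

theorem Valid.ordered [LinearOrder α] {h : Heap α} (v : h.Valid) : h.Ordered :=
  ⟨v.finite, v.first, v.pivot_first, v.pivot_le, v.lt_pivot⟩

theorem Valid.sized [LinearOrder α] {h : Heap α} (v : h.Valid) : h.Sized :=
  ⟨v.min_size, v.max_size⟩

theorem Ordered.lt [LinearOrder α] {h : Heap α} (o : h.Ordered) {i k : ℕ} (hik : i < k) {y z : α}
    (hy : y ∈ h.sets i) (hz : z ∈ h.sets k) : y < z :=
  WithBot.coe_lt_coe.1 ((o.lt_pivot i k hik ⟨z, hz⟩ y hy).trans_le (o.pivot_le k z hz))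

theorem Ordered.disjoint [LinearOrder α] {h : Heap α} (o : h.Ordered) {i k : ℕ} (hik : i < k) :
    Disjoint (h.sets i) (h.sets k) :=
  Finset.disjoint_left.2 fun _ hy hz => lt_irrefl _ (o.lt hik hy hz)

theorem Ordered.three_le [LinearOrder α] {h : Heap α} (o : h.Ordered) {i : ℕ}
    (hi : (h.sets i).Nonempty) : 3 ≤ i := by
  by_contra hc
  exact hi.ne_empty (o.first i (by omega))

/-- The maximum sizes telescope: F_{m+4} + F_{m+3} = F_{m+5}. -/
theorem above_le [LinearOrder α] {h : Heap α} (o : h.Ordered) (s : h.Sized) (m : ℕ) :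
    h.above m ≤ Nat.fib (m + 4) := by
  induction m with
  | zero => simp [above]
  | succ m ih =>
    have hm : (h.sets m).card ≤ Nat.fib (m + 3) := by
      rcases Nat.lt_or_ge m 3 with hm | hm
      · simp [o.first m hm]
      · exact s.max_size m hm
    have := @Nat.fib_add_two (m + 3)
    rw [above_succ, show m + 1 + 4 = m + 3 + 2 by omega, this]
    simp only [add_assoc, Nat.reduceAdd] at *
    omega

theorem above_eq_of_empty {h : Heap α} {m n : ℕ} (hmn : m ≤ n)
    (he : ∀ k, m ≤ k → k < n → h.sets k = ∅) : h.above n = h.above m := by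
  induction n, hmn using Nat.le_induction with
  | base => rfl
  | succ n hn ih =>
    rw [above_succ, ih fun k h1 h2 => he k h1 (by omega), he n hn (by omega)]
    simp

theorem Ordered.window [LinearOrder α] {h h' : Heap α} {a : ℕ} (o : h.Ordered)
    (w : Window h h' a) (ha : 3 ≤ a) (hp : h'.pivot 3 = ⊥)
    (hle : ∀ i, a ≤ i → i ≤ a + 2 → ∀ y ∈ h'.sets i, h'.pivot i ≤ (y : WithBot α))
    (hlt : ∀ i k, a ≤ i → i < k → k ≤ a + 2 → (h'.sets k).Nonempty →
      ∀ y ∈ h'.sets i, (y : WithBot α) < h'.pivot k)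
    (hbelow : ∀ k, a ≤ k → k ≤ a + 2 → (h'.sets k).Nonempty → ∀ i < a,
      ∀ y ∈ h.sets i, (y : WithBot α) < h'.pivot k) : h'.Ordered where
  finite := by
    obtain ⟨N, hN⟩ := o.finite
    refine ⟨N + a + 3, fun i hi => ?_⟩
    rw [w.sets_eq i (by omega) (by omega) (by omega)]
    exact hN i (by omega)
  first i hi := by
    rw [w.sets_eq i (by omega) (by omega) (by omega)]
    exact o.first i hi
  pivot_first := hp
  pivot_le i y hy := by
    by_cases hc : a ≤ i ∧ i ≤ a + 2
    · exact hle i hc.1 hc.2 y hy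
    · rw [w.sets_eq i (by omega) (by omega) (by omega)] at hy
      rw [w.pivot_eq i (by omega) (by omega) (by omega)]
      exact o.pivot_le i y hy
  lt_pivot i k hik hk y hy := by
    rcases Nat.lt_or_ge k a with hka | hka
    · rw [w.sets_eq _ (by omega) (by omega) (by omega)] at hy hk
      rw [w.pivot_eq _ (by omega) (by omega) (by omega)]
      exact o.lt_pivot i k hik hk y hy
    rcases Nat.lt_or_ge (a + 2) k with hka' | hka'
    · rw [w.sets_eq _ (by omega) (by omega) (by omega)] at hk
      rw [w.pivot_eq _ (by omega) (by omega) (by omega)]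
      by_cases hc : i = a ∨ i = a + 1 ∨ i = a + 2
      · have : y ∈ h'.sets a ∨ y ∈ h'.sets (a + 1) ∨ y ∈ h'.sets (a + 2) := by
          rcases hc with rfl | rfl | rfl <;> simp [hy]
        rcases (w.union y).1 this with h | h | h <;>
          exact o.lt_pivot _ k (by omega) hk y h
      · rw [w.sets_eq _ (by omega) (by omega) (by omega)] at hy
        exact o.lt_pivot i k hik hk y hy
    rcases Nat.lt_or_ge i a with hia | hia
    · rw [w.sets_eq _ (by omega) (by omega) (by omega)] at hy
      exact hbelow k hka hka' hk i hia y hy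
    · exact hlt i k hia hik hka' hk y hy

end Heap

variable {α : Type u} [LinearOrder α]

open Heap

/-! ### Correctness and amortized cost of each operation. -/

/-- What every single restructuring operation guarantees. -/
structure Exec.Sound (e : Exec α) : Prop where
  ordered : e.after.Ordered
  sized : e.after.Sized
  elems_eq : e.after.elems = e.before.elems
  cost : ¬ e.Exceptional → e.op.nominalCost + e.after.potential ≤ e.before.potential
  cost_le : e.op.nominalCost + e.after.potential ≤ e.before.potential + 1
  one_le : 1 ≤ e.op.nominalCost
  time_le : ∀ K, e.op.time K e.before ≤ 100 * K * e.op.nominalCost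

/-- The maximum size is not required of slot `a`, because an overflowing set may violate it. -/
theorem Heap.Window.sized {α : Type u} {h h' : Heap α} {a : ℕ} (w : Window h h' a)
    (hmin : ∀ i, 4 ≤ i → (h.sets i).Nonempty → Nat.fib i ≤ (h.sets i).card)
    (hmax : ∀ i, 3 ≤ i → i ≠ a → (h.sets i).card ≤ Nat.fib (i + 3))
    (hin : ∀ i, a ≤ i → i ≤ a + 2 → (h'.sets i).Nonempty →
      Nat.fib i ≤ (h'.sets i).card ∧ (h'.sets i).card ≤ Nat.fib (i + 3)) : h'.Sized where
  min_size i hi hne := by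
    by_cases hc : a ≤ i ∧ i ≤ a + 2
    · exact (hin i hc.1 hc.2 hne).1
    · rw [w.sets_eq i (by omega) (by omega) (by omega)] at hne ⊢
      exact hmin i hi hne
  max_size i hi := by
    rcases (h'.sets i).eq_empty_or_nonempty with he | hne
    · simp [he]
    by_cases hc : a ≤ i ∧ i ≤ a + 2
    · exact (hin i hc.1 hc.2 hne).2
    · rw [w.sets_eq i (by omega) (by omega) (by omega)]
      exact hmax i hi (by omega)

theorem overflowDown_sound {h h' : Heap α} {a : ℕ} (o : h.Ordered) (ha : 3 ≤ a)
    (hmin : ∀ i, 4 ≤ i → (h.sets i).Nonempty → Nat.fib i ≤ (h.sets i).card)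
    (hmax : ∀ i, 3 ≤ i → i ≠ a → (h.sets i).card ≤ Nat.fib (i + 3))
    (hcard : (h.sets a).card ≤ Nat.fib (a + 3) + 1)
    (hs : (Op.overflowDown a).Step h h') : Exec.Sound ⟨Op.overflowDown a, h, h'⟩ := by
  obtain ⟨hfull, he, heq⟩ := hs
  have s0 : h'.sets a = ∅ := by rw [heq]; simp
  have s1 : h'.sets (a + 1) = h.sets a := by rw [heq]; simp
  have s2 : h'.sets (a + 2) = h.sets (a + 2) := by rw [heq]; simp
  have p1 : h'.pivot (a + 1) = h.pivot a := by rw [heq]; simp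
  have p2 : ∀ i, i ≠ a + 1 → h'.pivot i = h.pivot i := by
    intro i hi; rw [heq]; simp [hi]
  have w : Window h h' a := by
    refine ⟨fun i h0 h1 _ => ?_, fun i _ h1 _ => p2 i h1, fun y => ?_, ?_⟩
    · rw [heq]; simp [h0, h1]
    · simp [s0, s1, s2, he]
    · simp [s0, s1, s2, he]
  clear heq
  have hne : (h.sets a).Nonempty := Finset.card_pos.1 (lt_of_lt_of_le (Nat.fib_pos.2 (by omega)) hfull)
  have hpot := w.potential_le o.finite (c := 1) (e := 0) (by
    rw [s0, s1, s2, he, Finset.card_empty, add_zero]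
    exact slotPot_overflowDown ha hfull hcard)
  refine ⟨o.window w ha (by rw [p2 _ (by omega), o.pivot_first]) ?_ ?_ ?_,
    w.sized hmin hmax ?_, w.elems_eq, fun _ => hpot, hpot.trans (by simp), le_rfl, fun K => ?_⟩
  · intro i h1 h2 y hy
    obtain rfl | rfl | rfl : i = a ∨ i = a + 1 ∨ i = a + 2 := by omega
    · simp [s0] at hy
    · rw [p1]; exact o.pivot_le _ y (s1 ▸ hy)
    · rw [p2 _ (by omega)]; exact o.pivot_le _ y (s2 ▸ hy)
  · intro i k h1 h2 h3 hk y hy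
    obtain rfl | rfl : i = a ∨ i = a + 1 := by omega
    · simp [s0] at hy
    · obtain rfl : k = a + 2 := by omega
      rw [p2 _ (by omega)]
      rw [s1] at hy
      rw [s2] at hk
      exact o.lt_pivot _ _ (by omega) hk y hy
  · intro k h1 h2 hk i hi y hy
    obtain rfl | rfl | rfl : k = a ∨ k = a + 1 ∨ k = a + 2 := by omega
    · simp [s0] at hk
    · rw [p1]; exact o.lt_pivot _ _ hi hne y hy
    · rw [p2 _ (by omega)]
      rw [s2] at hk
      exact o.lt_pivot _ _ (by omega) hk y hy
  · intro i h1 h2 hi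
    obtain rfl | rfl | rfl : i = a ∨ i = a + 1 ∨ i = a + 2 := by omega
    · simp [s0] at hi
    · rw [s1]
      have := Nat.fib_mono (show a + 1 ≤ a + 3 by omega)
      have := @Nat.fib_add_two (a + 2)
      have : 0 < Nat.fib (a + 2) := Nat.fib_pos.2 (by omega)
      simp only [add_assoc, Nat.reduceAdd] at *
      omega
    · rw [s2] at hi ⊢
      exact ⟨hmin _ (by omega) hi, hmax _ (by omega) (by omega)⟩
  · simp only [Op.time, Op.nominalCost]; omega

theorem overflowThru_sound {h h' : Heap α} {a : ℕ} (o : h.Ordered) (ha : 3 ≤ a)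
    (hmin : ∀ i, 4 ≤ i → (h.sets i).Nonempty → Nat.fib i ≤ (h.sets i).card)
    (hmax : ∀ i, 3 ≤ i → i ≠ a → (h.sets i).card ≤ Nat.fib (i + 3))
    (hcard : (h.sets a).card ≤ Nat.fib (a + 3) + 1)
    (hs : (Op.overflowThru a).Step h h') : Exec.Sound ⟨Op.overflowThru a, h, h'⟩ := by
  obtain ⟨hfull, hne1, he, A, B, x, y, hAB, hlt, hB, hx, hy, heq⟩ := hs
  have s0 : h'.sets a = ∅ := by rw [heq]; simp
  have s1 : h'.sets (a + 1) = A := by rw [heq]; simp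
  have s2 : h'.sets (a + 2) = B := by rw [heq]; simp
  have p1 : h'.pivot (a + 1) = x := by rw [heq]; simp
  have p2 : h'.pivot (a + 2) = y := by rw [heq]; simp
  have hne : (h.sets a).Nonempty := Finset.card_pos.1 (lt_of_lt_of_le (Nat.fib_pos.2 (by omega)) hfull)
  have hmem : ∀ z, (z ∈ A ∨ z ∈ B) ↔ (z ∈ h.sets a ∨ z ∈ h.sets (a + 1)) := by
    intro z; rw [← Finset.mem_union, hAB, Finset.mem_union]
  have hA : A.card = (h.sets (a + 1)).card := by
    have h1 := congrArg Finset.card hAB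
    rw [Finset.card_union_of_disjoint (o.disjoint (by omega)), Finset.card_union_of_disjoint] at h1
    · omega
    · exact Finset.disjoint_left.2 fun z hz hz' => lt_irrefl z (hlt z hz z hz')
  have w : Window h h' a := by
    refine ⟨fun i h0 h1 h2 => ?_, fun i _ h1 h2 => ?_, fun z => ?_, ?_⟩
    · rw [heq]; simp [h0, h1, h2]
    · rw [heq]; simp [h1, h2]
    · simp only [s0, s1, s2, he, Finset.notMem_empty, or_false, false_or]
      exact hmem z
    · simp only [s0, s1, s2, he, Finset.card_empty]; omega
  have hp3 : h'.pivot 3 = ⊥ := by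
    rw [heq, ← o.pivot_first]
    simp [show 3 ≠ a + 1 by omega, show 3 ≠ a + 2 by omega]
  clear heq
  have hbelow : ∀ z, (z ∈ A ∨ z ∈ B) → ∀ i < a, ∀ v ∈ h.sets i, (v : WithBot α) < (z : WithBot α) := by
    intro z hz i hi v hv
    rw [WithBot.coe_lt_coe]
    rcases (hmem z).1 hz with hz | hz
    · exact o.lt hi hv hz
    · exact o.lt (by omega) hv hz
  have ht := hmin _ (by omega) hne1
  have hpot := w.potential_le o.finite (c := max 1 (Nat.fib (a - 4))) (e := 0) (by
    rw [s0, s1, s2, he, Finset.card_empty, add_zero, hA, hB]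
    exact slotPot_overflowThru ha hfull hcard ht)
  refine ⟨o.window w ha hp3 ?_ ?_ ?_,
    w.sized hmin hmax ?_, w.elems_eq, fun _ => hpot, hpot.trans (by simp), le_max_left _ _,
    fun K => ?_⟩
  · intro i h1 h2 z hz
    obtain rfl | rfl | rfl : i = a ∨ i = a + 1 ∨ i = a + 2 := by omega
    · simp [s0] at hz
    · rw [p1, WithBot.coe_le_coe]; exact hx.2 (s1 ▸ hz)
    · rw [p2, WithBot.coe_le_coe]; exact hy.2 (s2 ▸ hz)
  · intro i k h1 h2 h3 hk z hz
    obtain rfl | rfl : i = a ∨ i = a + 1 := by omega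
    · simp [s0] at hz
    · obtain rfl : k = a + 2 := by omega
      rw [p2, WithBot.coe_lt_coe]
      exact hlt z (s1 ▸ hz) y hy.1
  · intro k h1 h2 hk i hi z hz
    obtain rfl | rfl | rfl : k = a ∨ k = a + 1 ∨ k = a + 2 := by omega
    · simp [s0] at hk
    · rw [p1]; exact hbelow x (Or.inl hx.1) i hi z hz
    · rw [p2]; exact hbelow y (Or.inr hy.1) i hi z hz
  · intro i h1 h2 hi
    obtain rfl | rfl | rfl : i = a ∨ i = a + 1 ∨ i = a + 2 := by omega
    · simp [s0] at hi
    · rw [s1, hA]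
      exact ⟨ht, hmax _ (by omega) (by omega)⟩
    · rw [s2, hB]
      have := Nat.fib_mono (show a + 2 ≤ a + 3 by omega)
      have := @Nat.fib_add_two (a + 3)
      have : 0 < Nat.fib (a + 4) := Nat.fib_pos.2 (by omega)
      have := Nat.fib_mono (show a + 4 ≤ a + 5 by omega)
      have : 0 < Nat.fib (a + 2) := Nat.fib_pos.2 (by omega)
      have := @Nat.fib_add_two (a + 2)
      simp only [add_assoc, Nat.reduceAdd] at *
      omega
  · simp only [Op.time, Op.nominalCost]
    have h1 := hmax (a + 1) (by omega) (by omega)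
    have key : (h.sets a).card + (h.sets (a + 1)).card ≤ 100 * max 1 (Nat.fib (a - 4)) := by
      rcases Nat.lt_or_ge a 5 with h5 | h5
      · have e1 := Nat.fib_mono (show a + 3 ≤ 7 by omega)
        have e2 := Nat.fib_mono (show a + 1 + 3 ≤ 8 by omega)
        rw [show Nat.fib 7 = 13 from rfl] at e1
        rw [show Nat.fib 8 = 21 from rfl] at e2
        omega
      · have e1 := fib_add_nine_le (a - 4) (by omega)
        rw [show a - 4 + 9 = a + 3 + 2 by omega, Nat.fib_add_two] at e1
        rw [show a + 1 + 3 = a + 3 + 1 by omega] at h1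
        omega
    calc K * ((h.sets a).card + (h.sets (a + 1)).card) ≤ K * (100 * max 1 (Nat.fib (a - 4))) :=
          Nat.mul_le_mul_left _ key
      _ = _ := by ring

theorem splitUp_sound {h h' : Heap α} {i : ℕ} (o : h.Ordered) (sz : h.Sized)
    (hs : (Op.splitUp i).Step h h') :
    Exec.Sound ⟨Op.splitUp i, h, h'⟩ ∧ h'.sets 4 = h.sets 4 := by
  obtain ⟨hi, hne, hemp, A, B, x, y, l, hAB, hlt, ⟨hl1, hl2⟩, ⟨hB1, hB2⟩, ⟨hA1, hA2⟩, hx, hy, heq⟩ := hs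
  obtain ⟨a, rfl⟩ : ∃ a, i = a + 2 := ⟨i - 2, by omega⟩
  have e0 : h.sets a = ∅ := hemp a (by omega) (by omega)
  have e1 : h.sets (a + 1) = ∅ := hemp _ (by omega) (by omega)
  simp only [show a + 2 - 1 = a + 1 by omega, show a + 2 - 2 = a by omega] at heq
  have s0 : h'.sets a = A := by rw [heq]; simp
  have s1 : h'.sets (a + 1) = B := by rw [heq]; simp
  have s2 : h'.sets (a + 2) = ∅ := by rw [heq]; simp
  have p0 : h'.pivot a = x := by rw [heq]; simp
  have p1 : h'.pivot (a + 1) = y := by rw [heq]; simp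
  have hmem : ∀ z, (z ∈ A ∨ z ∈ B) ↔ z ∈ h.sets (a + 2) := by
    intro z; rw [← Finset.mem_union, hAB]
  have hcard : A.card + B.card = (h.sets (a + 2)).card := by
    rw [← hAB, Finset.card_union_of_disjoint]
    exact Finset.disjoint_left.2 fun z hz hz' => lt_irrefl z (hlt z hz z hz')
  have w : Window h h' a := by
    refine ⟨fun i h0 h1 h2 => ?_, fun i h0 h1 _ => ?_, fun z => ?_, ?_⟩
    · rw [heq]; simp [h0, h1, h2]
    · rw [heq]; simp [h0, h1]
    · simp only [s0, s1, s2, e0, e1, Finset.notMem_empty, or_false, false_or]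
      exact hmem z
    · simp only [s0, s1, s2, e0, e1, Finset.card_empty]; omega
  clear heq
  refine ⟨?_, w.sets_eq _ (by omega) (by omega) (by omega)⟩
  have hbelow : ∀ z, (z ∈ A ∨ z ∈ B) → ∀ i < a, ∀ v ∈ h.sets i, (v : WithBot α) < (z : WithBot α) := by
    intro z hz i hi v hv
    rw [WithBot.coe_lt_coe]
    exact o.lt (by omega) hv ((hmem z).1 hz)
  obtain ⟨d, hd, hd1, hd2, hd3, hd4, hd5, hd6⟩ := split_sizes (by omega)
    (sz.min_size _ (by omega) hne) (sz.max_size _ (by omega)) hcard hl1 hl2 hB1 hB2 hA1 hA2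
  -- Emptiness of the slots from `a - 7` on is what makes the elements above few: the bound for slot
  -- `a - 7` is F_{a-3}.
  have hab : h.above a ≤ Nat.fib (a - 3) := by
    rw [above_eq_of_empty (m := a - 7) (by omega) fun k h1 h2 => hemp k (by omega) (by omega)]
    exact (above_le o sz _).trans_eq (by congr 1; omega)
  have hpot := w.potential_le o.finite (c := Nat.fib (a + 2 - 6)) (e := 0) (by
    rw [s0, s1, s2, e0, e1, Finset.card_empty]
    exact slotPot_splitUp (by omega) hab hcard hd hd1 hd2 hd3 hd4 hd5 hd6)
  refine ⟨o.window w (by omega) (by rw [w.pivot_eq _ (by omega) (by omega) (by omega), o.pivot_first])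
    ?_ ?_ ?_, w.sized sz.min_size (fun i hi _ => sz.max_size i hi) ?_, w.elems_eq, fun _ => hpot,
    hpot.trans (by simp), Nat.fib_pos.2 (by omega), fun K => ?_⟩
  · intro i h1 h2 z hz
    obtain rfl | rfl | rfl : i = a ∨ i = a + 1 ∨ i = a + 2 := by omega
    · rw [p0, WithBot.coe_le_coe]; exact hx.2 (s0 ▸ hz)
    · rw [p1, WithBot.coe_le_coe]; exact hy.2 (s1 ▸ hz)
    · simp [s2] at hz
  · intro i k h1 h2 h3 hk z hz
    obtain rfl | rfl : k = a + 1 ∨ k = a + 2 := by omega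
    · obtain rfl : i = a := by omega
      rw [p1, WithBot.coe_lt_coe]
      exact hlt z (s0 ▸ hz) y hy.1
    · simp [s2] at hk
  · intro k h1 h2 hk i hi z hz
    obtain rfl | rfl | rfl : k = a ∨ k = a + 1 ∨ k = a + 2 := by omega
    · rw [p0]; exact hbelow x (Or.inl hx.1) i hi z hz
    · rw [p1]; exact hbelow y (Or.inr hy.1) i hi z hz
    · simp [s2] at hk
  · intro i h1 h2 hi
    obtain rfl | rfl | rfl : i = a ∨ i = a + 1 ∨ i = a + 2 := by omega
    · rw [s0]
      exact ⟨(Nat.fib_mono (by omega)).trans hd5, hd6.trans (Nat.fib_mono (by omega))⟩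
    · rw [s1]
      exact ⟨(Nat.fib_mono (by omega)).trans hd3, hd4.trans (Nat.fib_mono (by omega))⟩
    · simp [s2] at hi
  · simp only [Op.time, Op.nominalCost]
    have h1 := sz.max_size (a + 2) (by omega)
    have h2 := fib_add_nine_le (a + 2 - 6) (by omega)
    rw [show a + 2 - 6 + 9 = a + 2 + 3 by omega] at h2
    calc K * (h.sets (a + 2)).card ≤ K * (100 * Nat.fib (a + 2 - 6)) :=
          Nat.mul_le_mul_left _ (by omega)
      _ = _ := by ring

theorem mergeDown_sound {h h' : Heap α} {i : ℕ} (o : h.Ordered) (sz : h.Sized)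
    (hs : (Op.mergeDown i).Step h h') :
    Exec.Sound ⟨Op.mergeDown i, h, h'⟩ ∧ (h.sets 4 = ∅ → h'.sets 4 = ∅) ∧
      (i = 5 → (h.sets 4).Nonempty ∧ h'.sets 4 = ∅) := by
  obtain ⟨hi, hne, hne0, hne1, he, heq⟩ := hs
  have h3 := o.three_le hne
  obtain ⟨a, rfl⟩ : ∃ a, i = a + 1 := ⟨i - 1, by omega⟩
  simp only [show a + 1 - 1 = a by omega, show a + 1 - 2 = a - 1 by omega,
    show a + 1 + 1 = a + 2 by omega] at *
  have s0 : h'.sets a = ∅ := by rw [heq]; simp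
  have s1 : h'.sets (a + 1) = ∅ := by rw [heq]; simp
  have s2 : h'.sets (a + 2) = h.sets a ∪ h.sets (a + 1) := by
    rw [heq]; simp
  have p2 : h'.pivot (a + 2) = h.pivot a := by rw [heq]; simp
  have hcard : (h'.sets (a + 2)).card = (h.sets a).card + (h.sets (a + 1)).card := by
    rw [s2, Finset.card_union_of_disjoint (o.disjoint (by omega))]
  have w : Window h h' a := by
    refine ⟨fun i h0 h1 h2 => ?_, fun i h0 h1 h2 => ?_, fun z => ?_, ?_⟩
    · rw [heq]; simp [h0, h1, h2]
    · rw [heq]; simp [h2]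
    · simp [s0, s1, s2, he]
    · rw [hcard]; simp [s0, s1, he]
  have hp3 : h'.pivot 3 = ⊥ := by
    rw [w.pivot_eq _ (by omega) (by omega) (by omega), o.pivot_first]
  clear heq
  have h4 : h.sets 4 = ∅ → h'.sets 4 = ∅ := fun h4 => by
    rwa [w.sets_eq 4 _ (by omega) (by omega)]
    rintro rfl
    simp [h4] at hne0
  refine ⟨?_, h4, fun h5 => ?_⟩
  swap
  · obtain rfl : a = 4 := by omega
    exact ⟨hne0, s0⟩
  have ha := sz.min_size a (by omega) hne0
  have hb := sz.min_size (a + 1) (by omega) hne1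
  have hpot : ∀ e ≤ 1, Nat.fib (a - 1) ≤ h.above a + e → 1 + h'.potential ≤ h.potential + e := by
    intro e h1 h2
    refine w.potential_le o.finite ?_
    rw [hcard, s0, s1, he, Finset.card_empty]
    exact slotPot_mergeDown (by omega) ha hb h1 h2
  have hab : h.above a = h.above (a - 1) + (h.sets (a - 1)).card := by
    rw [← above_succ, show a - 1 + 1 = a by omega]
  have hpos := hne.card_pos
  -- For `a = 4` the set above is S_3, which has no minimum size. It is nonempty, so it misses the
  -- target F_3 = 2 by at most 1.
  have hfib : a = 4 → Nat.fib (a - 1) = 2 := by rintro rfl; rfl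
  have hfib' : a ≠ 4 → Nat.fib (a - 1) ≤ (h.sets (a - 1)).card := fun h5 =>
    sz.min_size _ (by omega) hne
  refine ⟨o.window w (by omega) hp3 ?_ ?_ ?_,
    w.sized sz.min_size (fun i hi _ => sz.max_size i hi) ?_, w.elems_eq, fun hx => ?_,
    hpot 1 le_rfl ?_, le_rfl, fun K => ?_⟩
  · intro i h1 h2 z hz
    obtain rfl | rfl | rfl : i = a ∨ i = a + 1 ∨ i = a + 2 := by omega
    · simp [s0] at hz
    · simp [s1] at hz
    · rw [p2]
      rw [s2, Finset.mem_union] at hz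
      rcases hz with hz | hz
      · exact o.pivot_le a z hz
      · obtain ⟨v, hv⟩ := hne0
        exact (o.pivot_le a v hv).trans (WithBot.coe_le_coe.2 (o.lt (by omega) hv hz).le)
  · intro i k h1 h2 h3 hk z hz
    obtain rfl | rfl : i = a ∨ i = a + 1 := by omega
    · simp [s0] at hz
    · simp [s1] at hz
  · intro k h1 h2 hk i hi z hz
    obtain rfl | rfl | rfl : k = a ∨ k = a + 1 ∨ k = a + 2 := by omega
    · simp [s0] at hk
    · simp [s1] at hk
    · rw [p2]; exact o.lt_pivot i a hi hne0 z hz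
  · intro i h1 h2 hk
    obtain rfl | rfl | rfl : i = a ∨ i = a + 1 ∨ i = a + 2 := by omega
    · simp [s0] at hk
    · simp [s1] at hk
    · rw [hcard]
      have := sz.max_size a (by omega)
      have := sz.max_size (a + 1) (by omega)
      have := @Nat.fib_add_two a
      have := @Nat.fib_add_two (a + 3)
      simp only [add_assoc, Nat.reduceAdd] at *
      omega
  · refine hpot 0 (by omega) ?_
    by_cases h5 : a = 4
    · have : (h.sets (a - 1)).card ≠ 1 := by
        subst h5
        exact fun hc => hx ⟨rfl, hc⟩
      have := hfib h5
      omega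
    · have := hfib' h5
      omega
  · by_cases h5 : a = 4
    · have := hfib h5
      omega
    · have := hfib' h5
      omega
  · simp only [Op.time, Op.nominalCost]; omega

/-! ### The binary search: its result and its cost. -/

namespace Heap

theorem scan_spec {α : Type u} (h : Heap α) (d m : ℕ) :
    h.scan d m ≤ d ∧ (∀ k < h.scan d m, h.sets (m + k) = ∅) ∧
      (h.scan d m < d → (h.sets (m + h.scan d m)).Nonempty) := by
  induction d generalizing m with
  | zero => simp [scan]
  | succ d ih =>
    unfold scan
    split_ifs with hm
    · simpa using hm
    · obtain ⟨h1, h2, h3⟩ := ih (m + 1)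
      refine ⟨by omega, fun k hk => ?_, fun hd => ?_⟩
      · rcases k with _ | k
        · simpa [Finset.not_nonempty_iff_eq_empty] using hm
        · have := h2 k (by omega)
          rwa [show m + (k + 1) = m + 1 + k by omega]
      · rw [show m + (h.scan d (m + 1) + 1) = m + 1 + h.scan d (m + 1) by omega]
        exact h3 (by omega)

theorem searchFrom_spec {h : Heap α} (o : h.Ordered) (x : α) {lo hi : ℕ} (hle : lo ≤ hi) :
    lo ≤ (h.searchFrom x lo hi).1 ∧
      ((h.searchFrom x lo hi).1 = lo ∨ (h.sets (h.searchFrom x lo hi).1).Nonempty ∧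
        h.pivot (h.searchFrom x lo hi).1 ≤ (x : WithBot α)) ∧
      ∀ k, (h.searchFrom x lo hi).1 < k → k ≤ hi → (h.sets k).Nonempty →
        (x : WithBot α) < h.pivot k := by
  obtain ⟨n, hn⟩ : ∃ n, hi - lo ≤ n := ⟨_, le_rfl⟩
  induction n generalizing lo hi with
  | zero =>
    rw [searchFrom, dif_neg (by omega)]
    exact ⟨le_rfl, Or.inl rfl, fun k _ _ => by simp only at *; omega⟩
  | succ n ih =>
    rw [searchFrom]
    by_cases hlt : lo < hi
    swap
    · rw [dif_neg hlt]
      exact ⟨le_rfl, Or.inl rfl, fun k _ _ => by simp only at *; omega⟩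
    rw [dif_pos hlt]
    obtain ⟨g1, g2, g3⟩ := h.scan_spec (hi + 1 - (lo + hi + 1) / 2) ((lo + hi + 1) / 2)
    dsimp only
    generalize hm : (lo + hi + 1) / 2 = m at *
    generalize h.scan (hi + 1 - m) m = g at *
    split_ifs with hc
    · have hne := g3 (by omega)
      obtain ⟨r1, r2, r3⟩ := @ih (m + g) hi hc.1 (by omega)
      refine ⟨by omega, Or.inr ?_, r3⟩
      rcases r2 with r2 | r2
      · rw [r2]; exact ⟨hne, hc.2⟩
      · exact r2
    · obtain ⟨r1, r2, r3⟩ := @ih lo (m - 1) (by omega) (by omega)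
      refine ⟨r1, r2, fun k hk hkhi hkne => ?_⟩
      rcases Nat.lt_or_ge k m with hkm | hkm
      · exact r3 k hk (by omega) hkne
      obtain ⟨t, rfl⟩ : ∃ t, k = m + t := ⟨k - m, by omega⟩
      have ht : g ≤ t := by
        by_contra hcon
        exact hkne.ne_empty (g2 t (by omega))
      have hx : (x : WithBot α) < h.pivot (m + g) := by
        by_contra hcon
        exact hc ⟨by omega, not_lt.1 hcon⟩
      rcases ht.eq_or_lt with rfl | ht
      · exact hx
      -- An element of the probed slot separates its pivot from every later one, so pivots of
      -- present slots increase.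
      · obtain ⟨y, hy⟩ := g3 (by omega)
        exact hx.trans_le ((o.pivot_le _ y hy).trans (o.lt_pivot _ _ (by omega) hkne y hy).le)

theorem Ordered.bddAbove {h : Heap α} (o : h.Ordered) :
    BddAbove {i | (h.sets i).Nonempty} := by
  obtain ⟨N, hN⟩ := o.finite
  refine ⟨N, fun i hi => ?_⟩
  by_contra hc
  exact hi.ne_empty (hN i (by omega))

theorem Ordered.le_top {h : Heap α} (o : h.Ordered) {i : ℕ} (hi : (h.sets i).Nonempty) :
    i ≤ h.top :=
  le_csSup o.bddAbove hi

theorem Ordered.top_nonempty {h : Heap α} (o : h.Ordered) (ht : h.top ≠ 0) :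
    (h.sets h.top).Nonempty := by
  refine Nat.sSup_mem (s := {i | (h.sets i).Nonempty}) ?_ o.bddAbove
  by_contra hc
  rw [Set.not_nonempty_iff_eq_empty] at hc
  exact ht (by simp [top, hc])

theorem slot_spec {h : Heap α} (o : h.Ordered) (x : α) :
    3 ≤ h.slot x ∧ (h.slot x = 3 ∨ (h.sets (h.slot x)).Nonempty) ∧
      h.pivot (h.slot x) ≤ (x : WithBot α) ∧
      ∀ k, h.slot x < k → (h.sets k).Nonempty → (x : WithBot α) < h.pivot k := by
  rcases Nat.lt_or_ge h.top 3 with ht | ht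
  · have hs : h.slot x = 3 := by rw [slot, searchFrom, dif_neg (by omega)]
    rw [hs, o.pivot_first]
    refine ⟨le_rfl, Or.inl rfl, bot_le, fun k hk hne => ?_⟩
    have := o.le_top hne
    omega
  · obtain ⟨h1, h2, h3⟩ := searchFrom_spec o x ht
    change 3 ≤ h.slot x at h1
    change h.slot x = 3 ∨ (h.sets (h.slot x)).Nonempty ∧ h.pivot (h.slot x) ≤ (x : WithBot α) at h2
    refine ⟨h1, h2.imp id And.left, ?_, fun k hk hne => h3 k hk (o.le_top hne) hne⟩
    rcases h2 with h2 | h2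
    · rw [h2, o.pivot_first]; exact bot_le
    · exact h2.2

/-- A round halves the interval and passes at most eight absent slots; nine in a row would make the
last set empty. -/
theorem searchFrom_cost_le {h : Heap α} (v : h.Valid) (x : α) (ht : (h.sets h.top).Nonempty)
    (e : ℕ) {lo hi : ℕ} (hlo : 3 ≤ lo) (hhi : hi ≤ h.top) (hlt : hi - lo < 2 ^ e) :
    (h.searchFrom x lo hi).2 ≤ 9 * e := by
  induction e generalizing lo hi with
  | zero =>
    rw [pow_zero] at hlt
    rw [searchFrom, dif_neg (by omega)]
  | succ e ih =>
    rw [searchFrom]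
    by_cases hlt' : lo < hi
    swap
    · simp [dif_neg hlt']
    rw [dif_pos hlt']
    obtain ⟨g1, g2, g3⟩ := h.scan_spec (hi + 1 - (lo + hi + 1) / 2) ((lo + hi + 1) / 2)
    dsimp only
    generalize hm : (lo + hi + 1) / 2 = m at *
    generalize h.scan (hi + 1 - m) m = g at *
    have hg : g ≤ 8 := by
      by_contra hc
      exact ht.ne_empty (v.consecutive_empty m (by omega) (fun d hd => g2 d (by omega)) _ (by omega))
    rw [pow_succ] at hlt
    split_ifs with hc
    · have := @ih (m + g) hi (by omega) hhi (by omega)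
      dsimp only; omega
    · have := @ih lo (m - 1) hlo (by omega) (by omega)
      dsimp only; omega

theorem size_eq {α : Type u} {h : Heap α} {N : ℕ} (hN : ∀ i, N ≤ i → h.sets i = ∅) :
    h.size = ∑ i ∈ Finset.range N, (h.sets i).card :=
  finsum_eq_sum_range fun i hi => by simp [hN i hi]

theorem card_le_size {h : Heap α} (o : h.Ordered) (i : ℕ) : (h.sets i).card ≤ h.size := by
  obtain ⟨N, hN⟩ := o.finite
  rw [size_eq (N := N + i + 1) fun k hk => hN k (by omega)]
  exact Finset.single_le_sum (f := fun i => (h.sets i).card) (fun _ _ => Nat.zero_le _)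
    (Finset.mem_range.2 (by omega))

theorem one_le_lgLg {α : Type u} (h : Heap α) : 1 ≤ h.lgLg := le_max_left _ _

theorem two_pow_le_fib (q : ℕ) : 2 ^ q ≤ Nat.fib (2 * q + 2) := by
  induction q with
  | zero => simp
  | succ q ih =>
    have h1 := @Nat.fib_add_two (2 * q + 2)
    have h2 := @Nat.fib_le_fib_succ (2 * q + 2)
    rw [show 2 * (q + 1) + 2 = 2 * q + 2 + 2 by ring, pow_succ]
    omega

theorem searchCost_le {h : Heap α} (v : h.Valid) (x : α) :
    (h.searchCost x : ℝ) ≤ 45 * h.lgLg := by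
  have hone := h.one_le_lgLg
  rcases Nat.lt_or_ge h.top 4 with ht | ht
  · have : h.searchCost x = 0 := by rw [searchCost, searchFrom, dif_neg (by omega)]
    rw [this, Nat.cast_zero]
    positivity
  have hne := v.ordered.top_nonempty (by omega)
  have hcost : h.searchCost x ≤ 9 * (Nat.log 2 h.top + 1) :=
    searchFrom_cost_le v x hne _ le_rfl le_rfl
      (lt_of_le_of_lt (Nat.sub_le _ _) (Nat.lt_pow_succ_log_self (by norm_num) _))
  -- Chosen so that 2^q ≤ F_{2q+2} ≤ F_top ≤ n. Since `h.top` is at most 8q, its logarithm is at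
  -- most 3 + lg lg n.
  obtain ⟨q, hq⟩ : ∃ q, q = (h.top - 2) / 2 := ⟨_, rfl⟩
  have hpow : 2 ^ q ≤ h.size :=
    (two_pow_le_fib q).trans <| (Nat.fib_mono (by omega)).trans <|
      (v.min_size _ ht hne).trans (card_le_size v.ordered _)
  have hsz : (0 : ℝ) < h.size := by
    have := Nat.two_pow_pos q
    exact_mod_cast this.trans_le hpow
  have hq1 : (1 : ℝ) ≤ q := by
    have : 1 ≤ q := by omega
    exact_mod_cast this
  have hqL : (q : ℝ) ≤ Real.logb 2 h.size := by
    rw [Real.le_logb_iff_rpow_le (by norm_num) hsz, Real.rpow_natCast]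
    exact_mod_cast hpow
  have htop : (h.top : ℝ) ≤ 2 ^ (3 : ℝ) * q := by
    have : h.top ≤ 8 * q := by omega
    have h8 : (2 : ℝ) ^ (3 : ℝ) = 8 := by norm_num
    rw [h8]
    exact_mod_cast this
  have hlog : (Nat.log 2 h.top : ℝ) ≤ 3 + h.lgLg := by
    calc (Nat.log 2 h.top : ℝ) ≤ Real.logb 2 h.top := Real.natLog_le_logb _ _
      _ ≤ Real.logb 2 (2 ^ (3 : ℝ) * q) :=
          Real.logb_le_logb_of_le (by norm_num) (by exact_mod_cast (by omega : 0 < h.top)) htop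
      _ = 3 + Real.logb 2 q := by
          rw [Real.logb_mul (by positivity) (by positivity), Real.logb_rpow (by norm_num) (by norm_num)]
      _ ≤ 3 + Real.logb 2 (Real.logb 2 h.size) := by
          gcongr
          norm_num
      _ ≤ 3 + h.lgLg := by
          gcongr
          exact le_max_right _ _
  have hcost' : (h.searchCost x : ℝ) ≤ 9 * (Nat.log 2 h.top + 1) := by exact_mod_cast hcost
  linarith

/-! ### The plain insertion. -/

section AddTo

variable {h : Heap α} {x : α}

theorem addTo_sets_slot : (h.addTo x).sets (h.slot x) = insert x (h.sets (h.slot x)) := by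
  simp [addTo]

theorem addTo_sets_of_ne {i : ℕ} (hi : i ≠ h.slot x) : (h.addTo x).sets i = h.sets i := by
  simp [addTo, hi]

theorem addTo_card_slot (hx : x ∉ h.elems) :
    ((h.addTo x).sets (h.slot x)).card = (h.sets (h.slot x)).card + 1 := by
  rw [addTo_sets_slot, Finset.card_insert_of_notMem fun hm => hx ⟨_, hm⟩]

theorem subset_addTo (i : ℕ) : h.sets i ⊆ (h.addTo x).sets i := by
  by_cases hi : i = h.slot x
  · subst hi; rw [addTo_sets_slot]; exact Finset.subset_insert _ _
  · rw [addTo_sets_of_ne hi]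

theorem mem_addTo {i : ℕ} {y : α} (hy : y ∈ (h.addTo x).sets i) :
    y = x ∧ i = h.slot x ∨ y ∈ h.sets i := by
  by_cases hi : i = h.slot x
  · subst hi
    rw [addTo_sets_slot, Finset.mem_insert] at hy
    tauto
  · rw [addTo_sets_of_ne hi] at hy
    exact Or.inr hy

theorem addTo_elems : (h.addTo x).elems = insert x h.elems := by
  ext y
  constructor
  · rintro ⟨i, hi⟩
    rcases mem_addTo hi with ⟨rfl, -⟩ | hi
    · exact Set.mem_insert _ _
    · exact Or.inr ⟨i, hi⟩
  · rintro (rfl | ⟨i, hi⟩)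
    · exact ⟨_, by rw [addTo_sets_slot]; exact Finset.mem_insert_self _ _⟩
    · exact ⟨i, subset_addTo i hi⟩

theorem addTo_ordered (o : h.Ordered) : (h.addTo x).Ordered := by
  obtain ⟨h3, hs, hp, hlt⟩ := slot_spec o x
  refine ⟨?_, fun i hi => ?_, o.pivot_first, fun i y hy => ?_, fun i k hik hk y hy => ?_⟩
  · obtain ⟨N, hN⟩ := o.finite
    refine ⟨N + h.slot x + 1, fun i hi => ?_⟩
    rw [addTo_sets_of_ne (by omega)]
    exact hN i (by omega)
  · rw [addTo_sets_of_ne (by omega)]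
    exact o.first i hi
  · rcases mem_addTo hy with ⟨rfl, rfl⟩ | hy
    · exact hp
    · exact o.pivot_le i y hy
  · rcases (h.sets k).eq_empty_or_nonempty with he | hne
    -- A slot that becomes present is slot 3, and nothing is stored above it.
    · have hks : k = h.slot x := by
        by_contra hc
        rw [addTo_sets_of_ne hc, he] at hk
        simp at hk
      subst hks
      have hs3 : h.slot x = 3 := by simpa [he] using hs
      rw [addTo_sets_of_ne (by omega), o.first i (by omega)] at hy
      simp at hy
    · rcases mem_addTo hy with ⟨rfl, rfl⟩ | hy
      · exact hlt k hik hne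
      · exact o.lt_pivot i k hik hne y hy

theorem addTo_min_size (v : h.Valid) (i : ℕ) (hi : 4 ≤ i) (hne : ((h.addTo x).sets i).Nonempty) :
    Nat.fib i ≤ ((h.addTo x).sets i).card := by
  refine (v.min_size i hi ?_).trans (Finset.card_le_card (subset_addTo i))
  by_cases his : i = h.slot x
  · obtain ⟨-, hs, -⟩ := slot_spec v.ordered x
    subst his
    exact hs.resolve_left (by omega)
  · rwa [addTo_sets_of_ne his] at hne

theorem addTo_max_size (v : h.Valid) (i : ℕ) (hi : 3 ≤ i) (hne : i ≠ h.slot x) :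
    ((h.addTo x).sets i).card ≤ Nat.fib (i + 3) := by
  rw [addTo_sets_of_ne hne]
  exact v.max_size i hi

theorem addTo_sized (v : h.Valid) (hf : ¬ h.Full x) : (h.addTo x).Sized where
  min_size := addTo_min_size v
  max_size i hi := by
    by_cases his : i = h.slot x
    · subst his
      exact (not_le.1 hf).le
    · exact addTo_max_size v i hi his

theorem addTo_above_le (i : ℕ) : h.above i ≤ (h.addTo x).above i :=
  Finset.sum_le_sum fun j _ => Finset.card_le_card (subset_addTo j)

/-- Counts above a slot only grow, and the only slot that can become present is 3, whose target is
F_0 = 0. -/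
theorem addTo_upPot_le (v : h.Valid) (i : ℕ) : (h.addTo x).upPot i ≤ h.upPot i := by
  have := addTo_above_le (h := h) (x := x) i
  obtain ⟨-, hs, -⟩ := slot_spec v.ordered x
  by_cases hne : (h.sets i).Nonempty
  · unfold upPot
    simp only [hne, hne.mono (subset_addTo i)]
    split_ifs <;> omega
  · by_cases his : i = h.slot x
    · obtain rfl : i = 3 := by
        subst his; exact hs.resolve_right hne
      unfold upPot
      split_ifs <;> simp
    · simp [upPot, addTo_sets_of_ne his, hne]

/-- From F_i on the slopes are -1, 0 and 1. The upward jump on reaching F_i is met only in slot 3,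
where it is F_4 - F_3 = 1. -/
theorem slotSizePot_succ {i c : ℕ} (hi : 3 ≤ i) (hc : i = 3 ∨ Nat.fib i ≤ c) :
    slotSizePot i (c + 1) ≤ slotSizePot i c + 1 := by
  rcases hc with rfl | hc
  · simp only [slotSizePot]
    norm_num [Nat.fib]
    split_ifs <;> omega
  · have := @Nat.fib_add_two i
    have : 0 < Nat.fib i := Nat.fib_pos.2 (by omega)
    unfold slotSizePot
    split_ifs <;> omega

theorem addTo_sizePot_le (v : h.Valid) (hx : x ∉ h.elems) (i : ℕ) :
    (h.addTo x).sizePot i ≤ h.sizePot i + if i = h.slot x then 1 else 0 := by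
  obtain ⟨h3, hs, -⟩ := slot_spec v.ordered x
  rw [sizePot_eq, sizePot_eq]
  split_ifs with his
  · subst his
    rw [addTo_card_slot hx]
    refine slotSizePot_succ h3 ?_
    by_cases h4 : h.slot x = 3
    · exact Or.inl h4
    · exact Or.inr (v.min_size _ (by omega) (hs.resolve_left h4))
  · rw [addTo_sets_of_ne his, add_zero]

theorem addTo_setPot (i : ℕ) : (h.addTo x).setPot i =
    h.setPot i + if i = h.slot x ∧ h.sets (h.slot x) = ∅ then 1 else 0 := by
  by_cases his : i = h.slot x
  · subst his
    rcases (h.sets (h.slot x)).eq_empty_or_nonempty with he | hne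
    · simp [setPot, addTo_sets_slot, he]
    · simp [setPot, addTo_sets_slot, hne, hne.ne_empty]
  · simp [setPot, addTo_sets_of_ne his, his]

theorem exists_sum_range (o : h.Ordered) (x : α) : ∃ N, h.slot x < N ∧
    (∀ i, N ≤ i → h.sets i = ∅) ∧ (∀ i, N ≤ i → (h.addTo x).sets i = ∅) := by
  obtain ⟨N, hN⟩ := o.finite
  obtain ⟨M, hM⟩ := (addTo_ordered (x := x) o).finite
  exact ⟨N + M + h.slot x + 1, by omega, fun i hi => hN i (by omega), fun i hi => hM i (by omega)⟩

theorem finsum_pots_eq {α : Type u} {g : Heap α} {N : ℕ} (hN : ∀ i, N ≤ i → g.sets i = ∅) :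
    ∑ᶠ i, g.upPot i = ∑ i ∈ Finset.range N, g.upPot i ∧
    ∑ᶠ i, g.sizePot i = ∑ i ∈ Finset.range N, g.sizePot i ∧
    ∑ᶠ i, g.setPot i = ∑ i ∈ Finset.range N, g.setPot i :=
  ⟨finsum_eq_sum_range fun i hi => by simp [upPot, hN i hi],
    finsum_eq_sum_range fun i hi => by simp [sizePot, hN i hi],
    finsum_eq_sum_range fun i hi => by simp [setPot, hN i hi]⟩

theorem potential_eq_add {α : Type u} {g : Heap α} {N : ℕ} (hN : ∀ i, N ≤ i → g.sets i = ∅) :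
    g.potential = ∑ᶠ i, g.upPot i + ∑ᶠ i, g.sizePot i + ∑ᶠ i, g.setPot i := by
  obtain ⟨h1, h2, h3⟩ := finsum_pots_eq hN
  rw [h1, h2, h3, ← Finset.sum_add_distrib, ← Finset.sum_add_distrib]
  exact finsum_eq_sum_range fun i hi => by simp [upPot, sizePot, setPot, hN i hi]

theorem addTo_finsum_upPot_le (v : h.Valid) :
    ∑ᶠ i, (h.addTo x).upPot i ≤ ∑ᶠ i, h.upPot i := by
  obtain ⟨N, -, hN, hN'⟩ := exists_sum_range v.ordered x
  rw [(finsum_pots_eq hN).1, (finsum_pots_eq hN').1]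
  exact Finset.sum_le_sum fun i _ => addTo_upPot_le v i

theorem addTo_finsum_sizePot_le (v : h.Valid) (hx : x ∉ h.elems) :
    ∑ᶠ i, (h.addTo x).sizePot i ≤ (∑ᶠ i, h.sizePot i) + 1 := by
  obtain ⟨N, hlt, hN, hN'⟩ := exists_sum_range v.ordered x
  rw [(finsum_pots_eq hN).2.1, (finsum_pots_eq hN').2.1]
  refine (Finset.sum_le_sum fun i _ => addTo_sizePot_le v hx i).trans_eq ?_
  rw [Finset.sum_add_distrib, Finset.sum_ite_eq', if_pos (Finset.mem_range.2 hlt)]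

theorem addTo_finsum_setPot (o : h.Ordered) : ∑ᶠ i, (h.addTo x).setPot i =
    (∑ᶠ i, h.setPot i) + if h.sets (h.slot x) = ∅ then 1 else 0 := by
  obtain ⟨N, hlt, hN, hN'⟩ := exists_sum_range o x
  rw [(finsum_pots_eq hN).2.2, (finsum_pots_eq hN').2.2, Finset.sum_congr rfl fun i _ => addTo_setPot i,
    Finset.sum_add_distrib]
  congr 1
  split_ifs with he
  · simp only [he, and_true]
    rw [Finset.sum_ite_eq', if_pos (Finset.mem_range.2 hlt)]
  · simp [he]

theorem addTo_potential_le (v : h.Valid) (hx : x ∉ h.elems) :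
    (h.addTo x).potential ≤ h.potential + 2 := by
  obtain ⟨N, -, hN, hN'⟩ := exists_sum_range v.ordered x
  rw [potential_eq_add hN, potential_eq_add hN']
  have h1 := addTo_finsum_upPot_le (x := x) v
  have h2 := addTo_finsum_sizePot_le v hx
  have h3 := addTo_finsum_setPot (x := x) v.ordered
  split_ifs at h3 <;> omega

end AddTo

end Heap


/-! ### Operations that are due can be performed. -/

/-- A finite set can be cut into a lower and an upper part of given sizes. -/
theorem exists_lower_upper (S : Finset α) (a b : ℕ) (hab : a + b = S.card) :
    ∃ A B : Finset α, A ∪ B = S ∧ (∀ y ∈ A, ∀ z ∈ B, y < z) ∧ A.card = a ∧ B.card = b := by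
  induction b generalizing S with
  | zero => exact ⟨S, ∅, by simp, by simp, by omega, rfl⟩
  | succ b ih =>
    have hne : S.Nonempty := Finset.card_pos.1 (by omega)
    have hmem := S.max'_mem hne
    have hcard := Finset.card_erase_of_mem hmem
    obtain ⟨A, B, hU, hlt, hA, hB⟩ := ih (S.erase (S.max' hne)) (by omega)
    have hsub : ∀ y, y ∈ A ∨ y ∈ B → y ∈ S.erase (S.max' hne) := fun y hy => by
      rwa [← hU, Finset.mem_union]
    refine ⟨A, insert (S.max' hne) B, ?_, ?_, hA, ?_⟩
    · rw [Finset.union_insert, hU, Finset.insert_erase hmem]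
    · intro y hy z hz
      rcases Finset.mem_insert.1 hz with rfl | hz
      · exact S.lt_max'_of_mem_erase_max' hne (hsub y (Or.inl hy))
      · exact hlt y hy z hz
    · rw [Finset.card_insert_of_notMem, hB]
      intro hm
      exact Finset.notMem_erase _ _ (hsub _ (Or.inr hm))

theorem exists_splitUp {h : Heap α} (sz : h.Sized) {i : ℕ} (hi : 12 ≤ i) (hne : (h.sets i).Nonempty)
    (he : ∀ k, i - 9 ≤ k → k < i → h.sets k = ∅) : ∃ h', (Op.splitUp i).Step h h' := by
  have h1 := sz.min_size i (by omega) hne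
  have h2 := sz.max_size i (by omega)
  obtain ⟨l, hl0, hl1, hl2⟩ : ∃ l, 1 ≤ l ∧ Nat.fib (l + 2) ≤ (h.sets i).card ∧
      (h.sets i).card ≤ Nat.fib (l + 3) := by
    rcases le_total (h.sets i).card (Nat.fib (i + 1)) with h3 | h3
    · exact ⟨i - 2, by omega, by rwa [show i - 2 + 2 = i by omega],
        by rwa [show i - 2 + 3 = i + 1 by omega]⟩
    rcases le_total (h.sets i).card (Nat.fib (i + 2)) with h4 | h4
    · exact ⟨i - 1, by omega, by rwa [show i - 1 + 2 = i + 1 by omega],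
        by rwa [show i - 1 + 3 = i + 2 by omega]⟩
    · exact ⟨i, by omega, h4, h2⟩
  have e2 := @Nat.fib_add_two l
  have e3 := @Nat.fib_add_two (l + 1)
  have hmono := @Nat.fib_le_fib_succ l
  have hpos : 0 < Nat.fib l := Nat.fib_pos.2 (by omega)
  obtain ⟨a, b, hab, ha1, ha2, hb1, hb2⟩ : ∃ a b, a + b = (h.sets i).card ∧ Nat.fib l ≤ a ∧
      a ≤ Nat.fib (l + 1) ∧ Nat.fib (l + 1) ≤ b ∧ b ≤ Nat.fib (l + 2) := by
    -- The smallest lower part that is admissible and leaves at most F_{l+2} elements for the upper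
    -- one.
    refine ⟨max (Nat.fib l) ((h.sets i).card - Nat.fib (l + 2)),
      (h.sets i).card - max (Nat.fib l) ((h.sets i).card - Nat.fib (l + 2)), ?_⟩
    simp only [add_assoc, Nat.reduceAdd] at *
    omega
  obtain ⟨A, B, hU, hlt, rfl, rfl⟩ := exists_lower_upper (h.sets i) a b hab
  have hA : A.Nonempty := Finset.card_pos.1 (by omega)
  have hB : B.Nonempty := Finset.card_pos.1 (by omega)
  exact ⟨_, hi, hne, he, A, B, _, _, l, hU, hlt, ⟨hl1, hl2⟩, ⟨hb1, hb2⟩, ⟨ha1, ha2⟩,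
    A.isLeast_min' hA, B.isLeast_min' hB, rfl⟩

theorem exists_overflow {h : Heap α} (v : h.Valid) {x : α} (hf : h.Full x) :
    ∃ op h', (op = Op.overflowDown (h.slot x) ∨ op = Op.overflowThru (h.slot x)) ∧
      op.Step (h.addTo x) h' := by
  obtain ⟨h3, hs, -⟩ := slot_spec v.ordered x
  rcases ((h.addTo x).sets (h.slot x + 1)).eq_empty_or_nonempty with he | hne
  · exact ⟨_, _, Or.inl rfl, hf, he, rfl⟩
  have hcons := v.consecutive_nonempty (h.slot x)
  -- A full set has at least F_6 = 8 elements, so it was present before the insertion. The bound of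
  -- two consecutive nonempty sets then leaves room for an overflow-thru.
  have hslot : (h.sets (h.slot x)).Nonempty := by
    by_contra hc
    rw [Finset.not_nonempty_iff_eq_empty] at hc
    have h8 : Nat.fib (h.slot x + 3) ≤ 1 := by simpa [Full, addTo_sets_slot, hc] using hf
    have := Nat.fib_mono (show 6 ≤ h.slot x + 3 by omega)
    rw [show Nat.fib 6 = 8 from rfl] at this
    omega
  have he2 : (h.addTo x).sets (h.slot x + 2) = ∅ := by
    rw [addTo_sets_of_ne (by omega)] at hne ⊢
    by_contra hc
    exact hcons ⟨hslot, hne, Finset.nonempty_iff_ne_empty.2 hc⟩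
  have hpos : 0 < Nat.fib (h.slot x + 3) := Nat.fib_pos.2 (by omega)
  obtain ⟨A, B, hU, hlt, hA, hB⟩ := exists_lower_upper
    ((h.addTo x).sets (h.slot x) ∪ (h.addTo x).sets (h.slot x + 1))
    ((h.addTo x).sets (h.slot x + 1)).card ((h.addTo x).sets (h.slot x)).card (by
      rw [Finset.card_union_of_disjoint ((addTo_ordered v.ordered).disjoint (by omega)), add_comm])
  have hA' : A.Nonempty := Finset.card_pos.1 (hA ▸ hne.card_pos)
  have hB' : B.Nonempty := Finset.card_pos.1 (hB ▸ hpos.trans_le hf)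
  exact ⟨_, _, Or.inr rfl, hf, hne, he2, A, B, _, _, hU, hlt, hB, A.isLeast_min' hA',
    B.isLeast_min' hB', rfl⟩

theorem overflow_sound {h : Heap α} (v : h.Valid) {x : α} (hx : x ∉ h.elems) {op : Op}
    {h' : Heap α} (hop : op = Op.overflowDown (h.slot x) ∨ op = Op.overflowThru (h.slot x))
    (hs : op.Step (h.addTo x) h') : Exec.Sound ⟨op, h.addTo x, h'⟩ := by
  have h3 := (slot_spec v.ordered x).1
  have hcard : ((h.addTo x).sets (h.slot x)).card ≤ Nat.fib (h.slot x + 3) + 1 := by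
    rw [addTo_card_slot hx]
    exact Nat.succ_le_succ (v.max_size _ h3)
  rcases hop with rfl | rfl
  · exact overflowDown_sound (addTo_ordered v.ordered) h3 (addTo_min_size v) (addTo_max_size v)
      hcard hs
  · exact overflowThru_sound (addTo_ordered v.ordered) h3 (addTo_min_size v) (addTo_max_size v)
      hcard hs

/-- Split-ups fill only slots from 10 on and merge-downs only slots from 6 on, so an empty S_4 stays
empty. An exceptional merge-down needs S_4 and removes it. -/
theorem restore_sound {h h' : Heap α} {op : Op} (o : h.Ordered) (sz : h.Sized)
    (hop : ∃ i, op = Op.splitUp i ∨ op = Op.mergeDown i) (hs : op.Step h h') :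
    Exec.Sound ⟨op, h, h'⟩ ∧ (h.sets 4 = ∅ → h'.sets 4 = ∅) ∧
      (Exec.Exceptional ⟨op, h, h'⟩ → (h.sets 4).Nonempty ∧ h'.sets 4 = ∅) := by
  obtain ⟨i, rfl | rfl⟩ := hop
  · obtain ⟨h1, h2⟩ := splitUp_sound o sz hs
    exact ⟨h1, fun h4 => h2.trans h4, fun he => by cases he.1⟩
  · obtain ⟨h1, h2, h3⟩ := mergeDown_sound o sz hs
    exact ⟨h1, h2, fun he => h3 (by injection he.1)⟩

/-! ### Executions: total cost, termination and final heap. -/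

/-- The invariants of an execution of the insertion. -/
structure RunSpec (h : Heap α) (x : α) (es : List (Exec α)) (h' : Heap α) : Prop where
  ordered : h'.Ordered
  sized : (es = [] → ¬ h.Full x) → h'.Sized
  elems_eq : h'.elems = insert x h.elems
  sound : ∀ e ∈ es, e.Sound
  pairwise : es.Pairwise fun e f => ¬ (e.Exceptional ∧ f.Exceptional)
  cost : ((∀ e ∈ es, ¬ e.Exceptional) ∧
      (es.map fun e => e.op.nominalCost).sum + h'.potential ≤ (h.addTo x).potential) ∨
    (h'.sets 4 = ∅ ∧
      (es.map fun e => e.op.nominalCost).sum + h'.potential ≤ (h.addTo x).potential + 1)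

theorem InsertRun.spec {h : Heap α} (v : h.Valid) {x : α} (hx : x ∉ h.elems)
    {es : List (Exec α)} {h' : Heap α} (r : InsertRun h x es h') : RunSpec h x es h' := by
  induction r with
  | start =>
    exact ⟨addTo_ordered v.ordered, fun hf => addTo_sized v (hf rfl), addTo_elems, by simp, by simp,
      Or.inl (by simp)⟩
  | overflow op h' hfull hop hstep =>
    have hs := overflow_sound v hx hop hstep
    have hexc : ¬ Exec.Exceptional ⟨op, h.addTo x, h'⟩ := by
      rintro ⟨he, -⟩
      rcases hop with rfl | rfl <;> cases he
    refine ⟨hs.ordered, fun _ => hs.sized, hs.elems_eq.trans addTo_elems, by simpa using hs,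
      by simp, Or.inl ⟨by simpa using hexc, ?_⟩⟩
    simpa using hs.cost hexc
  | restore es h₁ op h₂ hrun hdue hop hstep ih =>
    obtain ⟨hs, h4, hexc⟩ := restore_sound ih.ordered (ih.sized hdue) hop hstep
    have hcost := hs.cost
    have hcost1 := hs.cost_le
    refine ⟨hs.ordered, fun _ => hs.sized, hs.elems_eq.trans ih.elems_eq, ?_, ?_, ?_⟩
    · intro e he
      rcases List.mem_append.1 he with he | he
      · exact ih.sound e he
      · rw [List.mem_singleton.1 he]; exact hs
    · refine List.pairwise_append.2 ⟨ih.pairwise, List.pairwise_singleton _ _, fun e he f hf => ?_⟩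
      rw [List.mem_singleton.1 hf]
      rintro ⟨h1, h2⟩
      rcases ih.cost with hc | hc
      · exact hc.1 e he h1
      · exact (hexc h2).1.ne_empty hc.1
    · rw [List.map_append, List.sum_append, List.map_singleton, List.sum_singleton]
      dsimp only at hcost hcost1 ⊢
      -- The presence of S_4 before an exceptional merge-down excludes the state in which the debt
      -- has already been incurred.
      by_cases hx' : Exec.Exceptional ⟨op, h₁, h₂⟩
      · obtain ⟨g1, g2⟩ := hexc hx'
        refine Or.inr ⟨g2, ?_⟩
        have := ih.cost.resolve_right fun hc => g1.ne_empty hc.1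
        omega
      · have := hcost hx'
        rcases ih.cost with hc | hc
        · refine Or.inl ⟨fun e he => ?_, by omega⟩
          rcases List.mem_append.1 he with he | he
          · exact hc.1 e he
          · rw [List.mem_singleton.1 he]; exact hx'
        · exact Or.inr ⟨h4 hc.1, by omega⟩

namespace RunSpec

variable {h h' : Heap α} {x : α} {es : List (Exec α)}

theorem cost_le (s : RunSpec h x es h') :
    (es.map fun e => e.op.nominalCost).sum + h'.potential ≤ (h.addTo x).potential + 1 := by
  rcases s.cost with hc | hc
  · exact hc.2.trans (Nat.le_succ _)
  · exact hc.2

theorem length_le (s : RunSpec h x es h') : es.length ≤ (h.addTo x).potential + 1 := by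
  have h1 : (es.map fun e => e.op.nominalCost).length • 1 ≤
      (es.map fun e => e.op.nominalCost).sum := by
    refine List.card_nsmul_le_sum _ _ fun n hn => ?_
    obtain ⟨e, he, rfl⟩ := List.mem_map.1 hn
    exact (s.sound e he).one_le
  have := s.cost_le
  simp only [List.length_map, smul_eq_mul, mul_one] at h1
  omega

theorem time_le (s : RunSpec h x es h') (K : ℕ) : (es.map fun e => e.op.time K e.before).sum ≤
    100 * K * (es.map fun e => e.op.nominalCost).sum := by
  rw [← List.sum_map_mul_left]
  exact List.sum_le_sum fun e he => (s.sound e he).time_le K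

end RunSpec

theorem exists_completeRun {h : Heap α} {x : α} {L : ℕ}
    (hL : ∀ es h', InsertRun h x es h' → es.length ≤ L) : ∃ es h', CompleteRun h x es h' := by
  by_contra! hc
  have key : ∀ n, ∃ es h', InsertRun h x es h' ∧ es.length = n := by
    intro n
    induction n with
    | zero => exact ⟨[], _, InsertRun.start, rfl⟩
    | succ n ih =>
      obtain ⟨es, h', hr, hn⟩ := ih
      have := hc es h'
      simp only [CompleteRun, not_and, not_forall, not_not] at this
      obtain ⟨e, h'', hr'⟩ := this hr
      exact ⟨_, h'', hr', by simp [hn]⟩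
  obtain ⟨es, h', hr, hn⟩ := key (L + 1)
  have := hL es h' hr
  omega

/-- A missing consecutive-set invariant would make a split-up or a merge-down applicable. -/
theorem CompleteRun.valid {h h' : Heap α} (v : h.Valid) {x : α} (hx : x ∉ h.elems)
    {es : List (Exec α)} (hc : CompleteRun h x es h') : h'.Valid := by
  obtain ⟨hr, hmax⟩ := hc
  have hdue : es = [] → ¬ h.Full x := by
    rintro rfl hf
    obtain ⟨op, h₁, hop, hs⟩ := exists_overflow v hf
    exact hmax _ h₁ (InsertRun.overflow op h₁ hf hop hs)
  have hno : ∀ op h₁, (∃ i, op = Op.splitUp i ∨ op = Op.mergeDown i) → ¬ op.Step h' h₁ :=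
    fun op h₁ hop hs => hmax _ h₁ (InsertRun.restore es h' op h₁ hr hdue hop hs)
  have s := hr.spec v hx
  have o := s.ordered
  have sz := s.sized hdue
  refine ⟨o.finite, o.first, o.pivot_first, o.pivot_le, o.lt_pivot, sz.min_size, sz.max_size,
    fun i hi he k => ?_, fun i hi => ?_⟩
  -- The first nonempty set after nine empty ones has index at least 12 and could be split up.
  · induction k using Nat.strong_induction_on with
    | _ k ih =>
      intro hik
      rcases Nat.lt_or_ge k (i + 9) with hk | hk
      · have := he (k - i) (by omega)
        rwa [show i + (k - i) = k by omega] at this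
      · by_contra hne
        obtain ⟨h₁, hs⟩ := exists_splitUp sz (by omega) (Finset.nonempty_iff_ne_empty.2 hne)
          fun j h1 h2 => ih j h2 (by omega)
        exact hno _ h₁ ⟨k, Or.inl rfl⟩ hs
  -- Without an applicable merge-down a run of three nonempty sets extends forever, contrary to
  -- finiteness.
  · have key : ∀ n, (h'.sets (i + n)).Nonempty ∧ (h'.sets (i + n + 1)).Nonempty ∧
        (h'.sets (i + n + 2)).Nonempty := by
      intro n
      induction n with
      | zero => exact hi
      | succ n ih =>
        refine ⟨ih.2.1, ih.2.2, ?_⟩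
        by_contra hne
        rw [Finset.not_nonempty_iff_eq_empty] at hne
        exact hno (Op.mergeDown (i + n + 2)) _ ⟨_, Or.inr rfl⟩
          ⟨by omega, ih.1, ih.2.1, ih.2.2, hne, rfl⟩
    obtain ⟨N, hN⟩ := o.finite
    exact (key N).1.ne_empty (hN _ (by omega))

end FHTNG

/-! ### The constants of the final bounds. -/

theorem mainTheorem6 :
    (∃ C : ℝ, ∀ (α : Type u) [LinearOrder α] (h : FHTNG.Heap α) (x : α),
      h.Valid → x ∉ h.elems →
      -- the binary search over the pivots
      (h.searchCost x : ℝ) ≤ C * h.lgLg ∧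
      -- the change of the three potentials by the plain insertion
      (∑ᶠ i, (h.addTo x).upPot i ≤ ∑ᶠ i, h.upPot i ∧
        ∑ᶠ i, (h.addTo x).sizePot i ≤ (∑ᶠ i, h.sizePot i) + 1 ∧
        ((h.sets (h.slot x)).Nonempty → ∑ᶠ i, (h.addTo x).setPot i = ∑ᶠ i, h.setPot i) ∧
        (h.sets (h.slot x) = ∅ →
          h.slot x = 3 ∧ ∑ᶠ i, (h.addTo x).setPot i = (∑ᶠ i, h.setPot i) + 1)) ∧
      -- every execution terminates
      (∃ L : ℕ, ∀ es h', FHTNG.InsertRun h x es h' → es.length ≤ L) ∧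
      (∃ es h', FHTNG.CompleteRun h x es h') ∧
      -- a completed execution has inserted the element and restored the invariants
      (∀ es h', FHTNG.CompleteRun h x es h' → h'.Valid ∧ h'.elems = insert x h.elems) ∧
      -- the amortized costs of the restructuring operations and of the whole insertion
      (∀ es h', FHTNG.InsertRun h x es h' →
        (∀ e ∈ es, ¬ e.Exceptional →
          e.op.nominalCost + e.after.potential ≤ e.before.potential) ∧
        (∀ e ∈ es, e.op.nominalCost + e.after.potential ≤ e.before.potential + 1) ∧
        es.Pairwise (fun e f => ¬ (e.Exceptional ∧ f.Exceptional)) ∧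
        (es.map fun e => e.op.nominalCost).sum + h'.potential ≤ (h.addTo x).potential + 1 ∧
        (FHTNG.insertCost h x es : ℝ) + ((h'.potential : ℝ) - (h.potential : ℝ))
          ≤ C * h.lgLg)) ∧
    -- the same for the time, with the potential scaled by a constant factor `a`
    (∀ K : ℕ, ∃ a C : ℝ, 0 < a ∧ ∀ (α : Type u) [LinearOrder α] (h : FHTNG.Heap α) (x : α),
      h.Valid → x ∉ h.elems → ∀ es h', FHTNG.InsertRun h x es h' →
        (FHTNG.insertTime K h x es : ℝ) + a * ((h'.potential : ℝ) - (h.potential : ℝ))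
          ≤ C * h.lgLg) := by
  -- 49 = 45 + 1 + 2 + 1: search, linking, potential of the new element, exceptional merge-down.
  refine ⟨⟨49, fun α _ h x v hx => ?_⟩, fun K => ?_⟩
  · have hlg := h.one_le_lgLg
    have hsearch := FHTNG.Heap.searchCost_le v x
    have hset := FHTNG.Heap.addTo_finsum_setPot (x := x) v.ordered
    have hL : ∀ es h', FHTNG.InsertRun h x es h' → es.length ≤ (h.addTo x).potential + 1 :=
      fun es h' hr => (hr.spec v hx).length_le
    refine ⟨by linarith, ⟨FHTNG.Heap.addTo_finsum_upPot_le v, FHTNG.Heap.addTo_finsum_sizePot_le v hx,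
      fun hne => ?_, fun he => ⟨?_, ?_⟩⟩, ⟨_, hL⟩, FHTNG.exists_completeRun hL,
      fun es h' hc => ⟨hc.valid v hx, (hc.1.spec v hx).elems_eq⟩, fun es h' hr => ?_⟩
    · rw [hset, if_neg hne.ne_empty, add_zero]
    · exact (FHTNG.Heap.slot_spec v.ordered x).2.1.resolve_right fun hne => hne.ne_empty he
    · rw [hset, if_pos he]
    · have s := hr.spec v hx
      refine ⟨fun e he => (s.sound e he).cost, fun e he => (s.sound e he).cost_le, s.pairwise,
        s.cost_le, ?_⟩
      have h1 : (((es.map fun e => e.op.nominalCost).sum : ℕ) : ℝ) + h'.potential ≤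
          h.potential + 3 := by
        have := s.cost_le
        have := FHTNG.Heap.addTo_potential_le v hx
        exact_mod_cast (by omega : (es.map fun e => e.op.nominalCost).sum + h'.potential ≤
          h.potential + 3)
      rw [FHTNG.insertCost, Nat.cast_add, Nat.cast_add, Nat.cast_one]
      linarith
  -- The factor 100 K turns nominal cost into time; adding 1 keeps `a` positive for `K = 0`. The
  -- search and the linking give 46 K, and the potential can yield at most 3 beyond its initial
  -- value.
  · refine ⟨100 * K + 1, 46 * K + 3 * (100 * K + 1), by positivity,
      fun α _ h x v hx es h' hr => ?_⟩
    have hlg := h.one_le_lgLg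
    have hsearch := FHTNG.Heap.searchCost_le v x
    have s := hr.spec v hx
    have h1 : (((es.map fun e => e.op.nominalCost).sum : ℕ) : ℝ) + h'.potential ≤
        h.potential + 3 := by
      have := s.cost_le
      have := FHTNG.Heap.addTo_potential_le v hx
      exact_mod_cast (by omega : (es.map fun e => e.op.nominalCost).sum + h'.potential ≤
        h.potential + 3)
    have h2 : (((es.map fun e => e.op.time K e.before).sum : ℕ) : ℝ) ≤
        100 * K * ((es.map fun e => e.op.nominalCost).sum : ℕ) := by
      exact_mod_cast s.time_le K
    rw [FHTNG.insertTime, Nat.cast_add, Nat.cast_mul, Nat.cast_add, Nat.cast_one]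
    generalize (es.map fun e => e.op.nominalCost).sum = S at h1 h2
    generalize (es.map fun e => e.op.time K e.before).sum = T at h2 ⊢
    have hK : (0 : ℝ) ≤ K := Nat.cast_nonneg K
    have hS : (0 : ℝ) ≤ S := Nat.cast_nonneg S
    calc (K : ℝ) * (h.searchCost x + 1) + T + (100 * K + 1) * ((h'.potential : ℝ) - h.potential)
        ≤ K * (46 * h.lgLg) + (100 * K + 1) * (S + ((h'.potential : ℝ) - h.potential)) := by
          have : (K : ℝ) * (h.searchCost x + 1) ≤ K * (46 * h.lgLg) :=
            mul_le_mul_of_nonneg_left (by linarith) hK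
          linarith
      _ ≤ K * (46 * h.lgLg) + (100 * K + 1) * (3 * h.lgLg) := by
          gcongr
          linarith
      _ = _ := by ring
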